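/- Let $\Omega\subset\mathbb{R}^3$ be a bounded $C^{2,1}$-domain, let $\alpha,\lambda\in\mathbb{R}$, $\eta>0$, $T>0$, $0<\beta<1$, and let $h\in C^{0,\beta}(\mathbb{R},L^2(\Omega,\mathbb{R}^3))$. For $v\in L^2(\Omega,\mathbb{R}^3)$ let $H[v]\in L^2(\mathbb{R}^3,\mathbb{R}^3)$ denote the stray field of $v$, i.e. the unique square integrable solution of $\operatorname{div}(H[v]+\chi_\Omega v)=0$, $\operatorname{curl}H[v]=0$ in $\mathbb{R}^3$ (in the sense of distributions). Let $H^2_N=H^2_N(\Omega,\mathbb{R}^3)$ be the space of all $v\in H^2(\Omega,\mathbb{R}^3)$ with $\frac{\partial v}{\partial\nu}=0$ on $\partial\Omega$, write $L^2=L^2(\Omega,\mathbb{R}^3)$, and let $$X=C^1([0,T],L^2)\cap C([0,T],H^2_N)\cap C^{0,\beta}_\beta(]0,T],H^2_N)\cap C^{1,\beta}_\beta(]0,T],L^2).$$ Here $C^{0,\beta}_\beta(]0,T],F)$ is the space of bounded functions $f:\,]0,T]\to F$ with $\sup_{0<\epsilon<T}\epsilon^\beta[f]_{C^{0,\beta}([\epsilon,T],F)}<\infty$,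 and $C^{1,\beta}_\beta(]0,T],F)$ is the space of bounded differentiable functions $f:\,]0,T]\to F$ with $f'\in C^{0,\beta}_\beta(]0,T],F)$. Let $u\in H^2_N$ with $|u|=1$ almost everywhere in $\Omega$, and let $m\in X$ be a solution of the rescaled Landau-Lifshitz-Gilbert equation $$m_t=\Delta m+\alpha\,m\times\Delta m+|\nabla m|^2m+\alpha\,\eta^2\,m\times(H[m]+\lambda h)-\eta^2\,m\times\big(m\times(H[m]+\lambda h)\big)$$ on $[0,T]$ (the equation holding in $L^2$ for every $t\in[0,T]$) with $m(0)=u$. Then, for every $t\in[0,T]$, $|m(t)|=1$ almost everywhere in $\Omega$. In particular this applies to $m=m(\cdot,u,\lambda)$ whenever $m(\cdot,u,\lambda)\in X$ is a solution with initial value $u$ in a neighborhood $U_\eta$ of a regular minimizer $m_\eta$ of $E^\eta_{\mathrm{res}}(m)=\int_\Omega|\nabla m|^2\,dx+\eta^2\int_{\mathbb{R}^3}|H[m]|^2\,dx$ over $H^1(\Omega,S^2)$, and parameter $\lambda$ in a neighborhood $V_\eta$ of $0$. -/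

import Mathlib

open MeasureTheory Set
open scoped ContDiff

namespace LLG

/-- Euclidean three-space `ℝ³`. -/
abbrev E3 : Type := EuclideanSpace ℝ (Fin 3)

/-- The `i`-th standard unit vector of `ℝ³`. -/
noncomputable def unitVec (i : Fin 3) : E3 := EuclideanSpace.single i (1 : ℝ)

/-- The vector product in `ℝ³`. -/
def cross (a b : E3) : E3 := WithLp.toLp 2 (crossProduct (WithLp.ofLp a) (WithLp.ofLp b))

/-- A bounded domain of class `C^{2,1}`: a bounded connected open set which, near each of its
boundary points and after a rigid motion, is the region above the graph of a function all of
whose derivatives up to order two are Lipschitz continuous. -/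
structure IsBoundedC21Domain (Ω : Set E3) : Prop where
  isOpen : IsOpen Ω
  isConnected : IsConnected Ω
  isBounded : Bornology.IsBounded Ω
  graph : ∀ x ∈ frontier Ω, ∃ r > 0, ∃ Φ : E3 ≃ᵢ E3, ∃ γ : EuclideanSpace ℝ (Fin 2) → ℝ,
    ContDiff ℝ 2 γ ∧
    (∀ k : ℕ, k ≤ 2 → ∃ K, LipschitzWith K (iteratedFDeriv ℝ k γ)) ∧
    ∀ y ∈ Metric.ball x r, (y ∈ Ω ↔ γ !₂[Φ y 0, Φ y 1] < Φ y 2)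

/-- The Lebesgue space `L²(Ω, ℝ³)`. -/
abbrev L2 (Ω : Set E3) : Type := Lp E3 2 (volume.restrict Ω)

/-- Smooth real functions with compact support contained in `Ω`. -/
structure IsTestFunction (Ω : Set E3) (φ : E3 → ℝ) : Prop where
  smooth : ContDiff ℝ ∞ φ
  compact : HasCompactSupport φ
  subset : tsupport φ ⊆ Ω

/-- `v ∈ L²(Ω, ℝ³)` is the weak partial derivative `∂ᵢ u` of `u ∈ L²(Ω, ℝ³)`. -/
def HasWeakPartial (Ω : Set E3) (i : Fin 3) (u v : L2 Ω) : Prop :=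
  ∀ φ : E3 → ℝ, IsTestFunction Ω φ →
    ∫ x in Ω, (fderiv ℝ φ x (unitVec i)) • u x = - ∫ x in Ω, φ x • v x

/-- Weak formulation of the homogeneous Neumann condition `∂u/∂ν = 0` on `∂Ω` for a function in
`H²(Ω, ℝ³)` with first derivatives `g i = ∂ᵢ u` and Laplacian `l = Δ u`:
`∫_Ω ∇u : ∇φ = - ∫_Ω Δu · φ` for every `φ ∈ H¹(Ω, ℝ³)`, that is, the boundary term
`∫_{∂Ω} ∂u/∂ν · φ` of Green's formula vanishes. -/
def WeakNeumann (Ω : Set E3) (g : Fin 3 → L2 Ω) (l : L2 Ω) : Prop :=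
  ∀ (φ : L2 Ω) (ψ : Fin 3 → L2 Ω), (∀ i, HasWeakPartial Ω i φ (ψ i)) →
    ∑ i, inner ℝ (g i) (ψ i) = - inner ℝ l φ

theorem IsTestFunction.integrable_smul {Ω : Set E3} {φ : E3 → ℝ} (hφ : IsTestFunction Ω φ)
    (u : L2 Ω) : Integrable (fun x => φ x • u x) (volume.restrict Ω) :=
  memLp_one_iff_integrable.1 (MemLp.smul (p := 2) (q := 2) (r := 1) (Lp.memLp u)
    (hφ.smooth.continuous.memLp_of_hasCompactSupport hφ.compact))

theorem IsTestFunction.integrable_fderiv_smul {Ω : Set E3} {φ : E3 → ℝ}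
    (hφ : IsTestFunction Ω φ) (i : Fin 3) (u : L2 Ω) :
    Integrable (fun x => (fderiv ℝ φ x (unitVec i)) • u x) (volume.restrict Ω) :=
  memLp_one_iff_integrable.1 (MemLp.smul (p := 2) (q := 2) (r := 1) (Lp.memLp u)
    (((hφ.smooth.continuous_fderiv (by simp)).clm_apply
      continuous_const).memLp_of_hasCompactSupport (hφ.compact.fderiv_apply ℝ _)))

theorem HasWeakPartial.zero (Ω : Set E3) (i : Fin 3) : HasWeakPartial Ω i 0 0 := by
  intro φ hφ
  have h0 : ∀ f : E3 → ℝ, ∫ x in Ω, f x • (0 : L2 Ω) x = 0 := fun f => by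
    rw [← integral_zero E3 E3 (μ := volume.restrict Ω)]
    apply integral_congr_ae
    filter_upwards [Lp.coeFn_zero E3 2 (volume.restrict Ω)] with x hx
    rw [hx, Pi.zero_apply, smul_zero]
  rw [h0 φ, h0 (fun x => fderiv ℝ φ x (unitVec i)), neg_zero]

theorem HasWeakPartial.add {Ω : Set E3} {i : Fin 3} {u v u' v' : L2 Ω}
    (h : HasWeakPartial Ω i u v) (h' : HasWeakPartial Ω i u' v') :
    HasWeakPartial Ω i (u + u') (v + v') := by
  intro φ hφ
  have e1 : ∫ x in Ω, (fderiv ℝ φ x (unitVec i)) • (u + u') x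
      = ∫ x in Ω, ((fderiv ℝ φ x (unitVec i)) • u x + (fderiv ℝ φ x (unitVec i)) • u' x) := by
    apply integral_congr_ae
    filter_upwards [Lp.coeFn_add u u'] with x hx
    rw [hx, Pi.add_apply, smul_add]
  have e2 : ∫ x in Ω, φ x • (v + v') x = ∫ x in Ω, (φ x • v x + φ x • v' x) := by
    apply integral_congr_ae
    filter_upwards [Lp.coeFn_add v v'] with x hx
    rw [hx, Pi.add_apply, smul_add]
  rw [e1, e2, integral_add (hφ.integrable_fderiv_smul i u) (hφ.integrable_fderiv_smul i u'),
    integral_add (hφ.integrable_smul v) (hφ.integrable_smul v'), h φ hφ, h' φ hφ, neg_add]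

theorem HasWeakPartial.smul {Ω : Set E3} {i : Fin 3} {u v : L2 Ω} (c : ℝ)
    (h : HasWeakPartial Ω i u v) : HasWeakPartial Ω i (c • u) (c • v) := by
  intro φ hφ
  have e1 : ∫ x in Ω, (fderiv ℝ φ x (unitVec i)) • (c • u) x
      = ∫ x in Ω, c • ((fderiv ℝ φ x (unitVec i)) • u x) := by
    apply integral_congr_ae
    filter_upwards [Lp.coeFn_smul c u] with x hx
    rw [hx, Pi.smul_apply, smul_comm]
  have e2 : ∫ x in Ω, φ x • (c • v) x = ∫ x in Ω, c • (φ x • v x) := by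
    apply integral_congr_ae
    filter_upwards [Lp.coeFn_smul c v] with x hx
    rw [hx, Pi.smul_apply, smul_comm]
  rw [e1, e2, integral_smul, integral_smul, h φ hφ, smul_neg]

/-- Indices of the derivatives of order at most two: the function itself, the first derivatives
`∂ᵢ`, and the second derivatives `∂ⱼ ∂ᵢ` (index `(i, j)`). -/
abbrev JetIdx : Type := Unit ⊕ (Fin 3 ⊕ (Fin 3 × Fin 3))

/-- Families of `L²` functions indexed by the derivatives of order at most two, with the norm
`(∑ₖ ‖wₖ‖²_{L²})^{1/2}`. -/
abbrev Jet (Ω : Set E3) : Type := PiLp 2 (fun _ : JetIdx => L2 Ω)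

/-- The space `H²_N(Ω, ℝ³)` as a subspace of the square integrable jets: functions in `L²(Ω, ℝ³)` with weak derivatives up to order two
in `L²(Ω, ℝ³)` that satisfy the homogeneous Neumann condition. A function is stored together with
its (uniquely determined) weak derivatives, so the norm is the usual `H²` norm. -/
noncomputable def H2NSubmodule (Ω : Set E3) : Submodule ℝ (Jet Ω) where
  carrier := {w |
    (∀ i, HasWeakPartial Ω i (w (Sum.inl ())) (w (Sum.inr (Sum.inl i)))) ∧
    (∀ i j, HasWeakPartial Ω j (w (Sum.inr (Sum.inl i))) (w (Sum.inr (Sum.inr (i, j))))) ∧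
    WeakNeumann Ω (fun i => w (Sum.inr (Sum.inl i))) (∑ i, w (Sum.inr (Sum.inr (i, i))))}
  zero_mem' := by
    refine ⟨fun i => HasWeakPartial.zero Ω i, fun i j => HasWeakPartial.zero Ω j, ?_⟩
    intro φ ψ _
    simp
  add_mem' := by
    rintro a b ⟨ha1, ha2, ha3⟩ ⟨hb1, hb2, hb3⟩
    refine ⟨fun i => (ha1 i).add (hb1 i), fun i j => (ha2 i j).add (hb2 i j), ?_⟩
    intro φ ψ h
    have h1 := ha3 φ ψ h
    have h2 := hb3 φ ψ h
    simp only [PiLp.add_apply, Finset.sum_add_distrib, inner_add_left] at h1 h2 ⊢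
    rw [h1, h2, neg_add]
  smul_mem' := by
    rintro c a ⟨ha1, ha2, ha3⟩
    refine ⟨fun i => (ha1 i).smul c, fun i j => (ha2 i j).smul c, ?_⟩
    intro φ ψ h
    have h1 := ha3 φ ψ h
    simp only [PiLp.smul_apply, ← Finset.smul_sum, real_inner_smul_left] at h1 ⊢
    rw [← Finset.mul_sum, h1, mul_neg]

/-- The normed space `H²_N(Ω, ℝ³)`. -/
abbrev H2N (Ω : Set E3) : Type := ↥(H2NSubmodule Ω)

namespace H2N

variable {Ω : Set E3}

/-- The underlying `L²` function. -/
noncomputable def fn (u : H2N Ω) : L2 Ω := u.1 (Sum.inl ())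

/-- The weak partial derivative `∂ᵢ u`. -/
noncomputable def partialDeriv (u : H2N Ω) (i : Fin 3) : L2 Ω := u.1 (Sum.inr (Sum.inl i))

/-- The Laplacian `Δ u = ∑ᵢ ∂ᵢ ∂ᵢ u`. -/
noncomputable def laplacian (u : H2N Ω) : L2 Ω := ∑ i, u.1 (Sum.inr (Sum.inr (i, i)))

end H2N

/-- `Hu ∈ L²(ℝ³, ℝ³)` is the stray field `H[u]` of `u ∈ L²(Ω, ℝ³)`: it is the (unique) square
integrable field with `div (Hu + χ_Ω u) = 0` and `curl Hu = 0` in `ℝ³` in the sense of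
distributions. -/
structure IsStrayField (Ω : Set E3) (u : L2 Ω) (Hu : Lp E3 2 (volume : Measure E3)) : Prop where
  div_eq_zero : ∀ φ : E3 → ℝ, IsTestFunction univ φ →
    (∫ x, fderiv ℝ φ x (Hu x)) + ∫ x in Ω, fderiv ℝ φ x (u x) = 0
  curl_eq_zero : ∀ φ : E3 → ℝ, IsTestFunction univ φ → ∀ i j : Fin 3,
    ∫ x, (Hu x i * fderiv ℝ φ x (unitVec j) - Hu x j * fderiv ℝ φ x (unitVec i)) = 0

section Holder

variable {F : Type*} [NormedAddCommGroup F]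

/-- The weighted Hölder space `C^{0,β}_β(]0,T], F)`: bounded functions `f` on `]0,T]` with
`sup_{0<ε<T} ε^β [f]_{C^{0,β}([ε,T],F)} < ∞`. -/
def MemWeightedHolder (T β : ℝ) (f : ℝ → F) : Prop :=
  (∃ M : ℝ, ∀ t ∈ Ioc 0 T, ‖f t‖ ≤ M) ∧
  ∃ C : ℝ, ∀ ε ∈ Ioo 0 T, ∀ s ∈ Icc ε T, ∀ t ∈ Icc ε T,
    ε ^ β * ‖f s - f t‖ ≤ C * |s - t| ^ β

/-- The space `C^{1,β}_β(]0,T], F)`: bounded differentiable functions on `]0,T]` whose derivative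
belongs to `C^{0,β}_β(]0,T], F)`. -/
def MemWeightedHolderOne [NormedSpace ℝ F] (T β : ℝ) (f : ℝ → F) : Prop :=
  (∃ M : ℝ, ∀ t ∈ Ioc 0 T, ‖f t‖ ≤ M) ∧
  DifferentiableOn ℝ f (Ioc 0 T) ∧
  MemWeightedHolder T β (derivWithin f (Ioc 0 T))

end Holder

/-- The solution space
`X = C¹([0,T],L²) ∩ C([0,T],H²_N) ∩ C^{0,β}_β(]0,T],H²_N) ∩ C^{1,β}_β(]0,T],L²)`
(only the values on `[0,T]` matter). -/
structure MemX (Ω : Set E3) (T β : ℝ) (m : ℝ → H2N Ω) : Prop where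
  contDiffOn : ContDiffOn ℝ 1 (fun t => H2N.fn (m t)) (Icc 0 T)
  continuousOn : ContinuousOn m (Icc 0 T)
  weightedHolder : MemWeightedHolder T β m
  weightedHolderOne : MemWeightedHolderOne T β (fun t => H2N.fn (m t))

/-- `m ∈ X` solves, on the time interval `[0,T]` and with homogeneous Neumann boundary conditions,
the rescaled Landau-Lifshitz-Gilbert equation
`m_t = Δm + α m × Δm + |∇m|² m + α η² m × (H[m] + λ h) - η² m × (m × (H[m] + λ h))`
with initial value `m(0) = u`. -/
structure IsSolution (Ω : Set E3) (α η T β : ℝ) (h : ℝ → L2 Ω) (lam : ℝ) (u : H2N Ω)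
    (m : ℝ → H2N Ω) : Prop where
  memX : MemX Ω T β m
  initial : m 0 = u
  equation : ∀ t ∈ Icc 0 T, ∃ Hm : Lp E3 2 (volume : Measure E3),
    IsStrayField Ω (H2N.fn (m t)) Hm ∧
    ∀ᵐ x ∂(volume.restrict Ω),
      (derivWithin (fun s => H2N.fn (m s)) (Icc 0 T) t : L2 Ω) x =
        H2N.laplacian (m t) x + α • cross (H2N.fn (m t) x) (H2N.laplacian (m t) x)
        + (∑ i, ‖H2N.partialDeriv (m t) i x‖ ^ 2) • H2N.fn (m t) x
        + (α * η ^ 2) • cross (H2N.fn (m t) x) (Hm x + lam • h t x)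
        - η ^ 2 • cross (H2N.fn (m t) x) (cross (H2N.fn (m t) x) (Hm x + lam • h t x))

end LLG

/-! Put w = |m|² - 1 and N(t) = ∫_Ω w². The claim is N = 0, which follows from Grönwall's inequality
once N' ≤ C N, since N(0) = 0.

Differentiating, N' = 4 ⟨w m, m_t⟩. Every term of the equation containing H[m] or h, and also m ×
Δm, is a vector product with m and hence orthogonal to m. What remains is m · m_t = m · Δm + |∇m|²
|m|². Integrating by parts against w m, with no boundary term by the Neumann condition, and using
|m|² = 1 + w, gives ⟨w m, m_t⟩ = ∫ w² |∇m|² - 2 ∑ᵢ ∫ (m · ∂ᵢm)² = ∫ w² |∇m|² - ½ ∫ |∇w|²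
(`H2N.inner_sphereDefect_smul`). By Cauchy-Schwarz the first integral is at most ‖w‖²_{L⁴}
‖∇m‖²_{L⁴}. The H² norm of m(t) is bounded on [0,T], so ‖∇m‖_{L⁴} is bounded, and the inequality
‖w‖⁴_{L⁴} ≤ C ‖w‖⁴_{L²} + ε ‖∇w‖⁴_{L²} with small ε lets the gradient term absorb the rest
(`H2N.exists_absorption`).

Three analytic facts carry this. The embeddings H¹ ⊂ L⁴ (with small ε) and W^{1,4} ⊂ L^∞ on Ω
(`IsBoundedC21Domain.embedsOn`) come from telescoping averages of u over shrinking cones that stay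
inside Ω. The chain rule for bounded H¹ functions (`IsSobolev.comp`) comes from mollification; it
makes w and w m admissible. The derivative of N (`hasDerivWithinAt_integral_sphereDefect_sq`) exists
although m is differentiable only in L², because the L^∞ bound makes the Taylor remainder quadratic
in the L² norm. -/

namespace LLG

open Filter Topology

/-! ### Averages over interior cones and their derivative in the radius. -/

section Weak

variable {F : Type*} [NormedAddCommGroup F] [NormedSpace ℝ F]

/-- `v` is the weak partial derivative `∂ᵢ u` on `Ω`. -/
def IsWeakPartial (Ω : Set E3) (i : Fin 3) (u v : E3 → F) : Prop :=
  ∀ φ : E3 → ℝ, IsTestFunction Ω φ →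
    ∫ x in Ω, (fderiv ℝ φ x (unitVec i)) • u x = - ∫ x in Ω, φ x • v x

/-- `u ∈ H¹(Ω)` with weak gradient `g`. -/
structure IsSobolev (Ω : Set E3) (u : E3 → F) (g : Fin 3 → E3 → F) : Prop where
  memLp : MemLp u 2 (volume.restrict Ω)
  memLp_grad : ∀ i, MemLp (g i) 2 (volume.restrict Ω)
  weak : ∀ i, IsWeakPartial Ω i u (g i)

/-- Every point of `S` is the vertex of a truncated cone with axis `e` contained in `Ω`. -/
structure InnerCone (Ω S : Set E3) (e : E3) (κ δ : ℝ) : Prop where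
  norm_le : ‖e‖ ≤ 1
  aperture_pos : 0 < κ
  aperture_le : κ ≤ 1
  height_pos : 0 < δ
  mem : ∀ x ∈ S, ∀ s, 0 < s → s ≤ δ → ∀ ζ, ‖ζ - e‖ ≤ κ → x + s • ζ ∈ Ω

/-- A smooth averaging kernel supported in the ball of radius `κ` around `e`. -/
structure IsConeKernel (e : E3) (κ : ℝ) (φ : E3 → ℝ) : Prop where
  smooth : ContDiff ℝ ∞ φ
  tsupport_subset : tsupport φ ⊆ Metric.closedBall e κ
  nonneg : ∀ x, 0 ≤ φ x
  integral_eq_one : ∫ x, φ x = 1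

theorem exists_isConeKernel (e : E3) {κ : ℝ} (hκ : 0 < κ) : ∃ φ, IsConeKernel e κ φ := by
  let f : ContDiffBump e := ⟨κ / 2, κ, by positivity, by linarith⟩
  exact ⟨f.normed volume, f.contDiff_normed, (f.tsupport_normed_eq).le, f.nonneg_normed,
    f.integral_normed⟩

theorem IsConeKernel.hasCompactSupport {e : E3} {κ : ℝ} {φ : E3 → ℝ} (h : IsConeKernel e κ φ) :
    HasCompactSupport φ :=
  (isCompact_closedBall e κ).of_isClosed_subset (isClosed_tsupport φ) h.tsupport_subset

theorem IsConeKernel.exists_bound {e : E3} {κ : ℝ} {φ : E3 → ℝ} (h : IsConeKernel e κ φ) :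
    ∃ B, 0 < B ∧ (∀ x, ‖φ x‖ ≤ B) ∧ ∀ x, ‖fderiv ℝ φ x x‖ ≤ B := by
  obtain ⟨B₁, h₁⟩ := h.hasCompactSupport.exists_bound_of_continuous h.smooth.continuous
  have hc : HasCompactSupport fun x => fderiv ℝ φ x x :=
    (h.hasCompactSupport.fderiv (𝕜 := ℝ)).mono' fun x hx =>
      subset_tsupport _ fun h0 => hx (by simp [h0])
  obtain ⟨B₂, h₂⟩ := hc.exists_bound_of_continuous
    ((h.smooth.continuous_fderiv (by simp)).clm_apply continuous_id)
  exact ⟨max 1 (max B₁ B₂), by positivity, fun x => (h₁ x).trans (by simp),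
    fun x => (h₂ x).trans (by simp)⟩

theorem IsConeKernel.eq_zero {e : E3} {κ : ℝ} {φ : E3 → ℝ} (h : IsConeKernel e κ φ) {x : E3}
    (hx : κ < ‖x - e‖) : φ x = 0 := by
  apply image_eq_zero_of_notMem_tsupport
  intro h'
  have := h.tsupport_subset h'
  rw [mem_closedBall_iff_norm] at this
  linarith

/-- The mean of `u` over `x + r • supp φ`, weighted by the rescaled kernel. -/
noncomputable def coneMean (Ω : Set E3) (φ : E3 → ℝ) (u : E3 → F) (x : E3) (r : ℝ) : F :=
  ∫ y in Ω, (r⁻¹ ^ 3 * φ (r⁻¹ • (y - x))) • u y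

variable {Ω S : Set E3} {e : E3} {κ δ : ℝ} {φ : E3 → ℝ}

/-- The support lies in x + r • closedBall e κ, which the cone condition puts inside Ω. Hence weak
derivatives may be tested with it for x arbitrarily near the boundary. -/
theorem isTestFunction_coneKernel (hS : InnerCone Ω S e κ δ) (hφ : IsConeKernel e κ φ) {x : E3}
    (hx : x ∈ S) {r : ℝ} (hr : 0 < r) (hr' : r ≤ δ) (i : Fin 3) :
    IsTestFunction Ω fun y => r⁻¹ ^ 4 * φ (r⁻¹ • (y - x)) * (y - x) i := by
  have hsub : (tsupport fun y => r⁻¹ ^ 4 * φ (r⁻¹ • (y - x)) * (y - x) i) ⊆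
      (fun y => r⁻¹ • (y - x)) ⁻¹' tsupport φ := by
    apply closure_minimal
    · intro y hy
      apply subset_tsupport
      intro h0
      apply hy
      simp [h0]
    · exact (isClosed_tsupport φ).preimage (by fun_prop)
  have hsub2 : (tsupport fun y => r⁻¹ ^ 4 * φ (r⁻¹ • (y - x)) * (y - x) i) ⊆
      (fun ζ => x + r • ζ) '' Metric.closedBall e κ := by
    intro y hy
    refine ⟨r⁻¹ • (y - x), hφ.tsupport_subset (hsub hy), ?_⟩
    simp [smul_smul, hr.ne']
  refine ⟨?_, ?_, ?_⟩
  · have h1 : ContDiff ℝ ∞ fun y : E3 => φ (r⁻¹ • (y - x)) := hφ.smooth.comp (by fun_prop)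
    have h2 : ContDiff ℝ ∞ fun y : E3 => (y - x) i := by fun_prop
    exact (contDiff_const.mul h1).mul h2
  · exact ((isCompact_closedBall e κ).image (by fun_prop)).of_isClosed_subset
      (isClosed_tsupport _) hsub2
  · intro y hy
    obtain ⟨ζ, hζ, rfl⟩ := hsub2 hy
    exact hS.mem x hx r hr hr' ζ (mem_closedBall_iff_norm.1 hζ)

/-- This divergence is minus the r-derivative of the averaging kernel r⁻³ φ((y - x)/r). That
identity turns a radial derivative of the average into an integral of the weak gradient. -/
theorem sum_fderiv_coneKernel (hφ : IsConeKernel e κ φ) (x y : E3) (r : ℝ) :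
    ∑ i, fderiv ℝ (fun y => r⁻¹ ^ 4 * φ (r⁻¹ • (y - x)) * (y - x) i) y (unitVec i) =
      3 * r⁻¹ ^ 4 * φ (r⁻¹ • (y - x)) +
        r⁻¹ ^ 4 * fderiv ℝ φ (r⁻¹ • (y - x)) (r⁻¹ • (y - x)) := by
  have hd : ∀ i : Fin 3, HasFDerivAt (fun y => r⁻¹ ^ 4 * φ (r⁻¹ • (y - x)) * (y - x) i)
      ((r⁻¹ ^ 4 * φ (r⁻¹ • (y - x))) • (EuclideanSpace.proj i : E3 →L[ℝ] ℝ) +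
        ((y - x) i) • (r⁻¹ ^ 4 • (fderiv ℝ φ (r⁻¹ • (y - x))).comp
          (r⁻¹ • ContinuousLinearMap.id ℝ E3))) y := by
    intro i
    have h1 : HasFDerivAt φ (fderiv ℝ φ (r⁻¹ • (y - x))) (r⁻¹ • (y - x)) :=
      (hφ.smooth.differentiable (by simp) _).hasFDerivAt
    have h2 : HasFDerivAt (fun y : E3 => r⁻¹ • (y - x)) (r⁻¹ • ContinuousLinearMap.id ℝ E3) y :=
      ((hasFDerivAt_id y).sub_const x).const_smul r⁻¹
    have h3 : HasFDerivAt (fun y : E3 => (y - x) i) (EuclideanSpace.proj i : E3 →L[ℝ] ℝ) y :=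
      (EuclideanSpace.proj i : E3 →L[ℝ] ℝ).hasFDerivAt.comp y ((hasFDerivAt_id y).sub_const x)
    exact ((h1.comp y h2).const_mul (r⁻¹ ^ 4)).mul h3
  have hsum : ∑ i, (y - x) i • (unitVec i : E3) = y - x := by
    ext j
    simp [unitVec, Fin.sum_univ_three]
    fin_cases j <;> simp
  have hlin : fderiv ℝ φ (r⁻¹ • (y - x)) (y - x) =
      ∑ i, (y - x) i * fderiv ℝ φ (r⁻¹ • (y - x)) (unitVec i) := by
    have := congrArg (fderiv ℝ φ (r⁻¹ • (y - x))) hsum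
    rw [← this, map_sum]
    simp only [map_smul, smul_eq_mul]
  simp only [(hd _).fderiv]
  have hu : ∀ i, (EuclideanSpace.proj i : E3 →L[ℝ] ℝ) (unitVec i) = 1 := by
    intro i; simp [unitVec]
  simp only [add_apply, smul_apply, hu, smul_eq_mul,
    ContinuousLinearMap.comp_apply, ContinuousLinearMap.id_apply, map_smul, hlin]
  simp only [Fin.sum_univ_three]
  ring

/-- Differentiate under the integral; the kernel's r-derivative is minus a divergence of test
functions on Ω, so the weak derivatives move it onto the gradient. -/
theorem hasDerivAt_coneMean (hΩ : Bornology.IsBounded Ω) (hS : InnerCone Ω S e κ δ)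
    (hφ : IsConeKernel e κ φ) {u : E3 → F} {g : Fin 3 → E3 → F} (hu : IsSobolev Ω u g) {x : E3}
    (hx : x ∈ S) {r : ℝ} (hr : 0 < r) (hr' : r ≤ δ) :
    HasDerivAt (coneMean Ω φ u x)
      (∑ i, ∫ y in Ω, (r⁻¹ ^ 4 * φ (r⁻¹ • (y - x)) * (y - x) i) • g i y) r := by
  have hfin : IsFiniteMeasure (volume.restrict Ω) :=
    ⟨by simpa using hΩ.measure_lt_top⟩
  have hui : Integrable u (volume.restrict Ω) := hu.memLp.integrable (by norm_num)
  obtain ⟨B, hB, hB1, hB2⟩ := hφ.exists_bound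
  have hcf : Continuous (fderiv ℝ φ) := hφ.smooth.continuous_fderiv (by simp)
  have hc := hφ.smooth.continuous
  let K' : ℝ → E3 → ℝ := fun s y => -(3 * s⁻¹ ^ 4 * φ (s⁻¹ • (y - x)) +
        s⁻¹ ^ 4 * fderiv ℝ φ (s⁻¹ • (y - x)) (s⁻¹ • (y - x)))
  have hmeas : ∀ f : E3 → ℝ, Continuous f →
      AEStronglyMeasurable (fun y => f y • u y) (volume.restrict Ω) := fun f hf =>
    hf.aestronglyMeasurable.smul hui.aestronglyMeasurable
  -- Staying on s > r/2 keeps s⁻¹ bounded. The factor 4 in the bound is 3 + 1, from differentiating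
  -- s⁻³ and the argument of φ.
  have key := hasDerivAt_integral_of_dominated_loc_of_deriv_le (𝕜 := ℝ) (μ := volume.restrict Ω)
    (F := fun s y => (s⁻¹ ^ 3 * φ (s⁻¹ • (y - x))) • u y) (F' := fun s y => K' s y • u y)
    (x₀ := r) (s := Ioi (r / 2)) (bound := fun y => (4 * (r / 2)⁻¹ ^ 4 * B) * ‖u y‖)
    (Ioi_mem_nhds (by linarith))
    (Eventually.of_forall fun s => hmeas _ (by fun_prop))
    ?_ (hmeas _ (by fun_prop)) ?_ (hui.norm.const_mul _) ?_
  · refine key.2.congr_deriv ?_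
    symm
    have hEq : ∀ i, ∫ y in Ω, (r⁻¹ ^ 4 * φ (r⁻¹ • (y - x)) * (y - x) i) • g i y =
        - ∫ y in Ω, (fderiv ℝ (fun y => r⁻¹ ^ 4 * φ (r⁻¹ • (y - x)) * (y - x) i) y
          (unitVec i)) • u y := by
      intro i
      rw [hu.weak i _ (isTestFunction_coneKernel hS hφ hx hr hr' i), neg_neg]
    simp only [hEq]
    rw [Finset.sum_neg_distrib, ← integral_finsetSum, ← integral_neg]
    · apply integral_congr_ae
      refine Eventually.of_forall fun y => ?_
      beta_reduce
      rw [← Finset.sum_smul, sum_fderiv_coneKernel hφ, neg_smul]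
    · intro i _
      have ht := isTestFunction_coneKernel hS hφ hx hr hr' i
      have h1 : Continuous fun y => fderiv ℝ
          (fun y => r⁻¹ ^ 4 * φ (r⁻¹ • (y - x)) * (y - x) i) y (unitVec i) :=
        (ht.smooth.continuous_fderiv (by simp)).clm_apply continuous_const
      obtain ⟨C, hC⟩ := (ht.compact.fderiv_apply ℝ (unitVec i)).exists_bound_of_continuous h1
      exact hui.bdd_smul C h1.aestronglyMeasurable (Eventually.of_forall hC)
  · refine hui.bdd_smul (r⁻¹ ^ 3 * B) (Continuous.aestronglyMeasurable (by fun_prop))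
      (Eventually.of_forall fun y => ?_)
    rw [norm_mul, Real.norm_of_nonneg (by positivity)]
    exact mul_le_mul_of_nonneg_left (hB1 _) (by positivity)
  · refine Eventually.of_forall fun y s hs => ?_
    have hs' : r / 2 < s := hs
    have hs0 : 0 < s := by linarith
    rw [norm_smul]
    refine mul_le_mul_of_nonneg_right ?_ (norm_nonneg _)
    have h1 : s⁻¹ ^ 4 ≤ (r / 2)⁻¹ ^ 4 := by gcongr
    have h2 : |φ (s⁻¹ • (y - x))| ≤ B := hB1 _
    have h3 : |fderiv ℝ φ (s⁻¹ • (y - x)) (s⁻¹ • (y - x))| ≤ B := hB2 _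
    simp only [K', norm_neg]
    calc _ ≤ ‖3 * s⁻¹ ^ 4 * φ (s⁻¹ • (y - x))‖ +
        ‖s⁻¹ ^ 4 * fderiv ℝ φ (s⁻¹ • (y - x)) (s⁻¹ • (y - x))‖ := norm_add_le _ _
      _ = 3 * s⁻¹ ^ 4 * |φ (s⁻¹ • (y - x))| +
        s⁻¹ ^ 4 * |fderiv ℝ φ (s⁻¹ • (y - x)) (s⁻¹ • (y - x))| := by
          simp only [norm_mul, Real.norm_eq_abs, abs_pow, abs_of_pos (inv_pos.2 hs0)]
          norm_num
      _ ≤ 3 * (r / 2)⁻¹ ^ 4 * B + (r / 2)⁻¹ ^ 4 * B := by gcongr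
      _ = _ := by ring
  · refine Eventually.of_forall fun y s hs => ?_
    have hs' : r / 2 < s := hs
    have hs0 : 0 < s := by linarith
    have h0 : HasDerivAt (fun s : ℝ => s⁻¹) (-(s ^ 2)⁻¹) s := hasDerivAt_inv hs0.ne'
    have h1 : HasFDerivAt φ (fderiv ℝ φ (s⁻¹ • (y - x))) (s⁻¹ • (y - x)) :=
      (hφ.smooth.differentiable (by simp) _).hasFDerivAt
    have h2 := h1.comp_hasDerivAt s (h0.smul_const (y - x))
    have h3 := ((h0.pow 3).mul h2).smul_const (u y)
    refine h3.congr_deriv ?_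
    congr 1
    simp only [K', map_smul, smul_eq_mul, Function.comp, Pi.pow_apply, ← inv_pow]
    generalize s⁻¹ = p
    push_cast
    ring

end Weak

end LLG

namespace LLG

open Filter Topology
open scoped ENNReal

/-! ### Oscillation of cone averages between comparable scales, and their limit at radius zero. -/

section Sobolev

variable {F : Type*} [NormedAddCommGroup F] [NormedSpace ℝ F]

/-- The size of the gradient, extended by zero outside `Ω`. -/
noncomputable def gradSize (Ω : Set E3) (g : Fin 3 → E3 → F) : E3 → ℝ≥0∞ :=
  Ω.indicator fun y => ∑ i, ‖g i y‖ₑ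

variable {Ω S : Set E3} {e : E3} {κ δ : ℝ} {φ : E3 → ℝ}

/-- The support of φ lies in the ball of radius ‖e‖ + κ ≤ 2 around the origin. -/
theorem IsConeKernel.eq_zero_of_two_mul_lt (hS : InnerCone Ω S e κ δ) (hφ : IsConeKernel e κ φ)
    {x y : E3} {r : ℝ} (hr : 0 < r) (h : 2 * r < ‖y - x‖) : φ (r⁻¹ • (y - x)) = 0 := by
  apply hφ.eq_zero
  have h1 : ‖r⁻¹ • (y - x)‖ = r⁻¹ * ‖y - x‖ := by
    rw [norm_smul, Real.norm_of_nonneg (by positivity)]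
  have h2 : 2 < r⁻¹ * ‖y - x‖ := by
    rw [inv_mul_eq_div, lt_div_iff₀ hr]; exact h
  have h3 := norm_sub_norm_le (r⁻¹ • (y - x)) e
  linarith [hS.norm_le, hS.aperture_le]

/-- The kernel is at most r⁻⁴ · B · 2r and lives in a ball of radius 2r. For b/16 ≤ r ≤ b both are
controlled by b, giving one bound for the whole range of radii, ready for the mean value inequality.
-/
theorem enorm_deriv_coneMean_le (hΩ : IsOpen Ω) (hS : InnerCone Ω S e κ δ)
    (hφ : IsConeKernel e κ φ) {B : ℝ} (hB : 0 < B) (hφB : ∀ x, ‖φ x‖ ≤ B)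
    {u : E3 → F} {g : Fin 3 → E3 → F} (hu : IsSobolev Ω u g) (x : E3)
    {r b : ℝ} (hr : 0 < r) (hrb : r ≤ b) (hbr : b ≤ 16 * r) :
    ‖∑ i, ∫ y in Ω, (r⁻¹ ^ 4 * φ (r⁻¹ • (y - x)) * (y - x) i) • g i y‖ₑ ≤
      ENNReal.ofReal (2 * B * 16 ^ 3 * b⁻¹ ^ 3) *
        ∫⁻ y in Metric.closedBall x (2 * b), gradSize Ω g y := by
  have hb : 0 < b := hr.trans_le hrb
  set c : ℝ := 2 * B * 16 ^ 3 * b⁻¹ ^ 3 with hc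
  have hk : ∀ i y, ‖r⁻¹ ^ 4 * φ (r⁻¹ • (y - x)) * (y - x) i‖ₑ ≤
      (Metric.closedBall x (2 * b)).indicator (fun _ => ENNReal.ofReal c) y := by
    intro i y
    by_cases hy : ‖y - x‖ ≤ 2 * r
    · have hmem : y ∈ Metric.closedBall x (2 * b) := by
        rw [mem_closedBall_iff_norm]; linarith
      rw [indicator_of_mem hmem, ← ofReal_norm]
      apply ENNReal.ofReal_le_ofReal
      have h1 : ‖(y - x) i‖ ≤ 2 * r := (PiLp.norm_apply_le (y - x) i).trans hy
      have h2 : r⁻¹ ≤ 16 * b⁻¹ := by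
        rw [inv_le_iff_one_le_mul₀ hr]
        field_simp
        exact hbr
      rw [norm_mul, norm_mul, Real.norm_of_nonneg (by positivity : 0 ≤ r⁻¹ ^ 4)]
      calc r⁻¹ ^ 4 * ‖φ (r⁻¹ • (y - x))‖ * ‖(y - x) i‖ ≤ r⁻¹ ^ 4 * B * (2 * r) := by
            gcongr; exact hφB _
        _ = 2 * B * r⁻¹ ^ 3 := by field_simp
        _ ≤ 2 * B * (16 * b⁻¹) ^ 3 := by gcongr
        _ = c := by rw [hc]; ring
    · rw [hφ.eq_zero_of_two_mul_lt hS hr (not_le.1 hy)]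
      simp
  have hmeas : ∀ i, AEMeasurable (fun y => ‖g i y‖ₑ) (volume.restrict Ω) := fun i =>
    (hu.memLp_grad i).aestronglyMeasurable.enorm
  calc _ ≤ ∑ i, ‖∫ y in Ω, (r⁻¹ ^ 4 * φ (r⁻¹ • (y - x)) * (y - x) i) • g i y‖ₑ :=
        enorm_sum_le _ _
    _ ≤ ∑ i, ∫⁻ y in Ω, ENNReal.ofReal c *
        (Metric.closedBall x (2 * b)).indicator (fun y => ‖g i y‖ₑ) y := by
        refine Finset.sum_le_sum fun i _ => (enorm_integral_le_lintegral_enorm _).trans ?_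
        refine lintegral_mono fun y => ?_
        rw [enorm_smul]
        refine (mul_le_mul_left (hk i y) _).trans ?_
        by_cases hy : y ∈ Metric.closedBall x (2 * b) <;> simp [hy]
    _ = ENNReal.ofReal c * ∑ i, ∫⁻ y in Ω,
        (Metric.closedBall x (2 * b)).indicator (fun y => ‖g i y‖ₑ) y := by
        rw [Finset.mul_sum]
        exact Finset.sum_congr rfl fun i _ => lintegral_const_mul' _ _ ENNReal.ofReal_ne_top
    _ = _ := by
        congr 1
        rw [gradSize, lintegral_indicator hΩ.measurableSet, Measure.restrict_restrict
          hΩ.measurableSet, lintegral_finsetSum' _ fun i _ => (hmeas i).mono_measure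
            (Measure.restrict_mono inter_subset_left le_rfl)]
        refine Finset.sum_congr rfl fun i _ => ?_
        rw [lintegral_indicator measurableSet_closedBall, Measure.restrict_restrict
          measurableSet_closedBall, inter_comm]

theorem lintegral_gradSize_lt_top (hΩ : IsOpen Ω) (hΩb : Bornology.IsBounded Ω)
    {u : E3 → F} {g : Fin 3 → E3 → F} (hu : IsSobolev Ω u g) (s : Set E3) :
    ∫⁻ y in s, gradSize Ω g y < ⊤ := by
  have hfin : IsFiniteMeasure (volume.restrict Ω) :=
    ⟨by simpa using hΩb.measure_lt_top⟩
  refine (setLIntegral_le_lintegral s _).trans_lt ?_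
  rw [gradSize, lintegral_indicator hΩ.measurableSet, lintegral_finsetSum' _ fun i _ =>
    (hu.memLp_grad i).aestronglyMeasurable.enorm]
  exact ENNReal.sum_lt_top.2 fun i _ => ((hu.memLp_grad i).integrable (by norm_num)).2

theorem enorm_coneMean_sub_le (hΩ : IsOpen Ω) (hΩb : Bornology.IsBounded Ω)
    (hS : InnerCone Ω S e κ δ)
    (hφ : IsConeKernel e κ φ) {B : ℝ} (hB : 0 < B) (hφB : ∀ x, ‖φ x‖ ≤ B)
    {u : E3 → F} {g : Fin 3 → E3 → F} (hu : IsSobolev Ω u g) {x : E3} (hx : x ∈ S)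
    {b : ℝ} (hb : 0 < b) (hbδ : b ≤ δ) :
    ‖coneMean Ω φ u x b - coneMean Ω φ u x (b / 16)‖ₑ ≤
      ENNReal.ofReal (2 * B * 16 ^ 3 * b⁻¹ ^ 2) *
        ∫⁻ y in Metric.closedBall x (2 * b), gradSize Ω g y := by
  set I := ∫⁻ y in Metric.closedBall x (2 * b), gradSize Ω g y
  have hI : I ≠ ⊤ := (lintegral_gradSize_lt_top hΩ hΩb hu _).ne
  have hfin : ENNReal.ofReal (2 * B * 16 ^ 3 * b⁻¹ ^ 3) * I ≠ ⊤ :=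
    ENNReal.mul_ne_top ENNReal.ofReal_ne_top hI
  have hle : b / 16 ≤ b := by linarith
  have hmv := norm_image_sub_le_of_norm_deriv_le_segment' (f := coneMean Ω φ u x) (a := b / 16)
    (b := b) (C := (ENNReal.ofReal (2 * B * 16 ^ 3 * b⁻¹ ^ 3) * I).toReal)
    (fun r hr => (hasDerivAt_coneMean hΩb hS hφ hu hx (by linarith [hr.1])
      (hr.2.trans hbδ)).hasDerivWithinAt)
    (fun r hr => by
      rw [← toReal_enorm]
      exact ENNReal.toReal_mono hfin (enorm_deriv_coneMean_le hΩ hS hφ hB hφB hu x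
        (by linarith [hr.1]) hr.2.le (by linarith [hr.1]))) b ⟨hle, le_rfl⟩
  rw [← ofReal_norm]
  calc _ ≤ ENNReal.ofReal ((ENNReal.ofReal (2 * B * 16 ^ 3 * b⁻¹ ^ 3) * I).toReal * b) := by
        apply ENNReal.ofReal_le_ofReal
        refine hmv.trans ?_
        gcongr
        linarith
    _ = ENNReal.ofReal (2 * B * 16 ^ 3 * b⁻¹ ^ 3) * I * ENNReal.ofReal b := by
        rw [ENNReal.ofReal_mul ENNReal.toReal_nonneg, ENNReal.ofReal_toReal hfin]
    _ = ENNReal.ofReal (2 * B * 16 ^ 3 * b⁻¹ ^ 3) * ENNReal.ofReal b * I := by ring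
    _ = _ := by
        rw [← ENNReal.ofReal_mul (by positivity)]
        congr 2
        field_simp

theorem enorm_coneMean_le {B : ℝ} (hφB : ∀ x, ‖φ x‖ ≤ B) (u : E3 → F) (x : E3) {r : ℝ} (hr : 0 < r) :
    ‖coneMean Ω φ u x r‖ₑ ≤ ENNReal.ofReal (r⁻¹ ^ 3 * B) * ∫⁻ y in Ω, ‖u y‖ₑ := by
  rw [← lintegral_const_mul' _ _ ENNReal.ofReal_ne_top]
  refine (enorm_integral_le_lintegral_enorm _).trans (lintegral_mono fun y => ?_)
  rw [enorm_smul]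
  gcongr
  rw [← ofReal_norm, norm_mul, Real.norm_of_nonneg (by positivity : 0 ≤ r⁻¹ ^ 3)]
  exact ENNReal.ofReal_le_ofReal (mul_le_mul_of_nonneg_left (hφB _) (by positivity))

theorem volume_closedBall_two_mul (x : E3) {b : ℝ} (hb : 0 < b) :
    volume (Metric.closedBall x (2 * b)) =
      ENNReal.ofReal (b ^ 3) * volume (Metric.closedBall (0 : E3) 2) := by
  rw [mul_comm, Measure.addHaar_closedBall_mul_of_pos _ _ hb]
  simp

/-- The means over shrinking cones converge to the function almost everywhere. -/
theorem ae_tendsto_coneMean [CompleteSpace F] (hΩ : IsOpen Ω)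
    (hS : InnerCone Ω S e κ δ) (hφ : IsConeKernel e κ φ) {u : E3 → F}
    (hu : Integrable u (volume.restrict Ω)) :
    ∀ᵐ x, x ∈ S → x ∈ Ω → Tendsto (coneMean Ω φ u x) (𝓝[>] 0) (𝓝 (u x)) := by
  obtain ⟨B, hB, hφB, -⟩ := hφ.exists_bound
  set v : E3 → F := Ω.indicator u with hv
  have hvi : Integrable v := (integrable_indicator_iff hΩ.measurableSet).2 hu
  -- The parameter 0 restricts the differentiation theorem to balls centred at x itself; a cone
  -- average is dominated by an average over such a ball, of comparable volume.
  have hleb := IsUnifLocDoublingMeasure.ae_tendsto_average_norm_sub (volume : Measure E3)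
    hvi.locallyIntegrable 0
  filter_upwards [hleb] with x hx hxS hxΩ
  have hvx : v x = u x := indicator_of_mem hxΩ u
  set A : ℝ → ℝ := fun r => ⨍ y in Metric.closedBall x (2 * r), ‖v y - v x‖
  have hA : Tendsto A (𝓝[>] 0) (𝓝 0) := by
    refine hx (fun _ => x) (fun r => 2 * r) ?_ ?_
    · refine tendsto_nhdsWithin_iff.2 ⟨?_, ?_⟩
      · have : Tendsto (fun r : ℝ => 2 * r) (𝓝 0) (𝓝 (2 * 0)) := by
          exact tendsto_id.const_mul 2
        rw [mul_zero] at this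
        exact this.mono_left nhdsWithin_le_nhds
      · filter_upwards [self_mem_nhdsWithin] with r hr
        have : (0 : ℝ) < r := hr
        simpa using this
    · exact Eventually.of_forall fun r => by simp
  set V := (volume (Metric.closedBall (0 : E3) 2)).toReal
  have hbound : ∀ r, 0 < r → ‖coneMean Ω φ u x r - u x‖ ≤ B * V * A r := by
    intro r hr
    set k : E3 → ℝ := fun y => r⁻¹ ^ 3 * φ (r⁻¹ • (y - x)) with hk
    have hkc : Continuous k := by
      have := hφ.smooth.continuous
      fun_prop
    have hkz : ∀ y, y ∉ Metric.closedBall x (2 * r) → k y = 0 := by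
      intro y hy
      rw [mem_closedBall_iff_norm, not_le] at hy
      simp [hk, hφ.eq_zero_of_two_mul_lt hS hr hy]
    have hkB : ∀ y, ‖k y‖ ≤ r⁻¹ ^ 3 * B := fun y => by
      rw [norm_mul, Real.norm_of_nonneg (by positivity : 0 ≤ r⁻¹ ^ 3)]
      exact mul_le_mul_of_nonneg_left (hφB _) (by positivity)
    have hkcs : HasCompactSupport k :=
      HasCompactSupport.intro (isCompact_closedBall x (2 * r)) hkz
    have hkint : Integrable k := hkc.integrable_of_hasCompactSupport hkcs
    have hk1 : ∫ y, k y = 1 := by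
      simp only [hk]
      rw [integral_const_mul]
      have h1 := integral_sub_right_eq_self (μ := (volume : Measure E3))
        (fun y => φ (r⁻¹ • y)) x
      rw [h1, Measure.integral_comp_inv_smul, hφ.integral_eq_one]
      simp [abs_of_pos hr]
      field_simp
    have hkv : Integrable fun y => k y • v y :=
      hvi.bdd_smul _ hkc.aestronglyMeasurable (Eventually.of_forall hkB)
    have hcm : coneMean Ω φ u x r = ∫ y, k y • v y := by
      rw [coneMean, ← integral_indicator hΩ.measurableSet]
      refine integral_congr_ae (Eventually.of_forall fun y => ?_)
      by_cases hy : y ∈ Ω <;> simp [hv, hy, hk]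
    have hsub : coneMean Ω φ u x r - u x = ∫ y, k y • (v y - v x) := by
      simp only [smul_sub]
      rw [integral_sub hkv (hkint.smul_const _), integral_smul_const, hk1, one_smul, hcm, hvx]
    have hloc : IntegrableOn (fun y => ‖v y - v x‖) (Metric.closedBall x (2 * r)) :=
      (hvi.integrableOn.sub (integrableOn_const measure_closedBall_lt_top.ne)).norm
    rw [hsub]
    calc _ ≤ ∫ y, (Metric.closedBall x (2 * r)).indicator
          (fun y => r⁻¹ ^ 3 * B * ‖v y - v x‖) y := by
          refine norm_integral_le_of_norm_le
            ((integrable_indicator_iff measurableSet_closedBall).2 (hloc.const_mul _))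
            (Eventually.of_forall fun y => ?_)
          rw [norm_smul]
          by_cases hy : y ∈ Metric.closedBall x (2 * r)
          · rw [indicator_of_mem hy]
            exact mul_le_mul_of_nonneg_right (hkB y) (norm_nonneg _)
          · rw [indicator_of_notMem hy, hkz y hy]
            simp
      _ = r⁻¹ ^ 3 * B * ∫ y in Metric.closedBall x (2 * r), ‖v y - v x‖ := by
          rw [integral_indicator measurableSet_closedBall, integral_const_mul]
      _ = B * V * A r := by
          have hV : 0 < V := ENNReal.toReal_pos
            (Metric.measure_closedBall_pos _ _ (by norm_num)).ne' measure_closedBall_lt_top.ne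
          have hvol : volume.real (Metric.closedBall x (2 * r)) = r ^ 3 * V := by
            rw [measureReal_def, volume_closedBall_two_mul x hr, ENNReal.toReal_mul,
              ENNReal.toReal_ofReal (by positivity)]
          simp only [A]
          rw [setAverage_eq, hvol, smul_eq_mul]
          field_simp
  rw [tendsto_iff_norm_sub_tendsto_zero]
  have h0 : Tendsto (fun r => B * V * A r) (𝓝[>] 0) (𝓝 0) := by
    simpa using hA.const_mul (B * V)
  refine squeeze_zero' (Eventually.of_forall fun _ => norm_nonneg _) ?_ h0
  filter_upwards [self_mem_nhdsWithin] with r hr using hbound r hr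

end Sobolev

end LLG

/-! ### Hölder and Jensen inequalities for fourth powers. -/

namespace LLG

open Filter Topology
open scoped ENNReal

theorem lintegral_sq_le {X : Type*} [MeasurableSpace X] (μ : Measure X) {f : X → ℝ≥0∞}
    (hf : AEMeasurable f μ) : (∫⁻ x, f x ∂μ) ^ 2 ≤ μ univ * ∫⁻ x, f x ^ 2 ∂μ := by
  have h := ENNReal.lintegral_mul_le_Lp_mul_Lq μ (p := 2) (q := 2)
    (Real.HolderConjugate.two_two) (aemeasurable_const (b := (1 : ℝ≥0∞))) hf
  simp only [Pi.mul_apply, one_mul, lintegral_const, ENNReal.rpow_two, one_pow] at h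
  calc (∫⁻ x, f x ∂μ) ^ 2 ≤ (μ univ ^ (1 / 2 : ℝ) * (∫⁻ x, f x ^ 2 ∂μ) ^ (1 / 2 : ℝ)) ^ 2 := by
        gcongr
    _ = _ := by
        rw [mul_pow, ← ENNReal.rpow_two, ← ENNReal.rpow_two, ← ENNReal.rpow_mul,
          ← ENNReal.rpow_mul]
        norm_num

theorem lintegral_pow_four_le {X : Type*} [MeasurableSpace X] (μ : Measure X) {f : X → ℝ≥0∞}
    (hf : AEMeasurable f μ) : (∫⁻ x, f x ∂μ) ^ 4 ≤ μ univ ^ 3 * ∫⁻ x, f x ^ 4 ∂μ := by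
  have h1 := lintegral_sq_le μ hf
  have h2 := lintegral_sq_le μ (hf.pow_const 2)
  simp only [← pow_mul] at h2
  calc (∫⁻ x, f x ∂μ) ^ 4 = ((∫⁻ x, f x ∂μ) ^ 2) ^ 2 := by rw [← pow_mul]
    _ ≤ (μ univ * ∫⁻ x, f x ^ 2 ∂μ) ^ 2 := by gcongr
    _ = μ univ ^ 2 * (∫⁻ x, f x ^ 2 ∂μ) ^ 2 := mul_pow _ _ _
    _ ≤ μ univ ^ 2 * (μ univ * ∫⁻ x, f x ^ 4 ∂μ) := by gcongr
    _ = _ := by ring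

/-- Jensen's inequality for the fourth power of a weighted series. -/
theorem tsum_mul_pow_four_le (w c : ℕ → ℝ≥0∞) :
    (∑' j, w j * c j) ^ 4 ≤ (∑' j, w j) ^ 3 * ∑' j, w j * c j ^ 4 := by
  set μ : Measure ℕ := Measure.sum fun j => w j • Measure.dirac j
  have hμ : ∀ f : ℕ → ℝ≥0∞, ∫⁻ j, f j ∂μ = ∑' j, w j * f j := by
    intro f
    simp [μ, lintegral_sum_measure, lintegral_smul_measure]
  have h := lintegral_pow_four_le μ (measurable_of_countable c).aemeasurable
  have hu : μ univ = ∑' j, w j := by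
    simpa using hμ fun _ => 1
  rwa [hμ, hμ, hu] at h

theorem ennreal_add_pow_four_le (a b : ℝ≥0∞) : (a + b) ^ 4 ≤ 16 * (a ^ 4 + b ^ 4) := by
  have h : ∀ a b : ℝ≥0∞, a ≤ b → (a + b) ^ 4 ≤ 16 * (a ^ 4 + b ^ 4) := by
    intro a b hab
    calc (a + b) ^ 4 ≤ (b + b) ^ 4 := by gcongr
      _ = 16 * b ^ 4 := by ring
      _ ≤ _ := by gcongr; exact le_add_self
  rcases le_total a b with hab | hab
  · exact h a b hab
  · rw [add_comm a b, add_comm (a ^ 4)]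
    exact h b a hab

/-! ### Integrals over balls of fixed radius, as functions of the centre. -/

section BallMean

variable {G : E3 → ℝ≥0∞}

theorem aemeasurable_lintegral_closedBall (hG : AEMeasurable G) (R : ℝ) :
    AEMeasurable fun x => ∫⁻ y in Metric.closedBall x R, G y := by
  have hD : MeasurableSet {p : E3 × E3 | dist p.2 p.1 ≤ R} :=
    measurableSet_le (measurable_snd.dist measurable_fst) measurable_const
  have hGp : AEMeasurable (fun p : E3 × E3 => G p.2) (volume.prod volume) :=
    hG.comp_quasiMeasurePreserving Measure.quasiMeasurePreserving_snd
  have h := (hGp.indicator hD).lintegral_prod_right'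
  refine h.congr (Eventually.of_forall fun x => ?_)
  beta_reduce
  rw [← lintegral_indicator measurableSet_closedBall]
  rfl

theorem lintegral_lintegral_closedBall (hG : AEMeasurable G) (R : ℝ) :
    ∫⁻ x, ∫⁻ y in Metric.closedBall x R, G y =
      volume (Metric.closedBall (0 : E3) R) * ∫⁻ y, G y := by
  have hD : MeasurableSet {p : E3 × E3 | dist p.2 p.1 ≤ R} :=
    measurableSet_le (measurable_snd.dist measurable_fst) measurable_const
  have hGp : AEMeasurable (fun p : E3 × E3 => G p.2) (volume.prod volume) :=
    hG.comp_quasiMeasurePreserving Measure.quasiMeasurePreserving_snd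
  have h := lintegral_lintegral_swap (μ := (volume : Measure E3)) (ν := (volume : Measure E3))
    (f := fun x y => {p : E3 × E3 | dist p.2 p.1 ≤ R}.indicator (fun p => G p.2) (x, y))
    (hGp.indicator hD)
  calc _ = ∫⁻ x, ∫⁻ y, {p : E3 × E3 | dist p.2 p.1 ≤ R}.indicator (fun p => G p.2) (x, y) := by
        refine lintegral_congr fun x => ?_
        rw [← lintegral_indicator measurableSet_closedBall]
        rfl
    _ = ∫⁻ y, volume (Metric.closedBall (0 : E3) R) * G y := by
        rw [h]
        refine lintegral_congr fun y => ?_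
        rw [← Measure.addHaar_closedBall_center (volume : Measure E3) y R, mul_comm,
          ← setLIntegral_const, ← lintegral_indicator measurableSet_closedBall]
        refine lintegral_congr fun x => ?_
        by_cases hx : dist x y ≤ R
        · rw [indicator_of_mem (by simpa [dist_comm] using hx), indicator_of_mem (by simpa using hx)]
        · rw [indicator_of_notMem (by simpa [dist_comm] using hx),
            indicator_of_notMem (by simpa using hx)]
    _ = _ := lintegral_const_mul' _ _ measure_closedBall_lt_top.ne

theorem lintegral_closedBall_pow_four_le (hG : AEMeasurable G) (x : E3) (R : ℝ) :
    (∫⁻ y in Metric.closedBall x R, G y) ^ 4 ≤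
      volume (Metric.closedBall (0 : E3) R) ^ 3 * ∫⁻ y, G y ^ 4 := by
  refine (lintegral_pow_four_le _ hG.restrict).trans ?_
  rw [Measure.restrict_apply_univ, Measure.addHaar_closedBall_center]
  gcongr
  exact Measure.restrict_le_self

/-- Split the fourth power into two squares and apply Cauchy-Schwarz to each. One square is bounded
by the integral over the whole space, the other is integrated in x by Tonelli. The power V³ is the
same as in the pointwise L⁴ bound `lintegral_closedBall_pow_four_le`, so one scaling serves both
embeddings. -/
theorem lintegral_lintegral_closedBall_pow_four_le (hG : AEMeasurable G)
    (hG2 : ∫⁻ y, G y ^ 2 ≠ ⊤) (R : ℝ) :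
    ∫⁻ x, (∫⁻ y in Metric.closedBall x R, G y) ^ 4 ≤
      volume (Metric.closedBall (0 : E3) R) ^ 3 * (∫⁻ y, G y ^ 2) ^ 2 := by
  set V := volume (Metric.closedBall (0 : E3) R)
  have hV : V ≠ ⊤ := measure_closedBall_lt_top.ne
  have hsq : ∀ x, (∫⁻ y in Metric.closedBall x R, G y) ^ 2 ≤
      V * ∫⁻ y in Metric.closedBall x R, G y ^ 2 := by
    intro x
    refine (lintegral_sq_le _ hG.restrict).trans ?_
    rw [Measure.restrict_apply_univ, Measure.addHaar_closedBall_center]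
  calc _ ≤ ∫⁻ x, (V * ∫⁻ y, G y ^ 2) * (V * ∫⁻ y in Metric.closedBall x R, G y ^ 2) := by
        refine lintegral_mono fun x => ?_
        calc _ = (∫⁻ y in Metric.closedBall x R, G y) ^ 2 *
              (∫⁻ y in Metric.closedBall x R, G y) ^ 2 := by rw [← pow_add]
          _ ≤ _ := by
            refine mul_le_mul' ((hsq x).trans ?_) (hsq x)
            gcongr
            exact Measure.restrict_le_self
    _ = (V * ∫⁻ y, G y ^ 2) * (V * (V * ∫⁻ y, G y ^ 2)) := by
        rw [lintegral_const_mul' _ _ (ENNReal.mul_ne_top hV hG2), lintegral_const_mul' _ _ hV,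
          lintegral_lintegral_closedBall (hG.pow_const 2)]
    _ = _ := by ring

end BallMean

/-! ### Bounds for the gradient size, and the pointwise telescoping estimate. -/

section Sobolev

variable {F : Type*} [NormedAddCommGroup F] [NormedSpace ℝ F]
variable {Ω S : Set E3} {e : E3} {κ δ : ℝ} {φ : E3 → ℝ}

theorem aemeasurable_gradSize (hΩ : IsOpen Ω) {u : E3 → F} {g : Fin 3 → E3 → F}
    (hu : IsSobolev Ω u g) : AEMeasurable (gradSize Ω g) := by
  rw [gradSize, aemeasurable_indicator_iff hΩ.measurableSet]
  exact Finset.aemeasurable_fun_sum _ fun i _ => (hu.memLp_grad i).aestronglyMeasurable.enorm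

theorem lintegral_sq_lt_top {F : Type*} [NormedAddCommGroup F] {X : Type*} [MeasurableSpace X] {μ : Measure X} {f : X → F}
    (hf : MemLp f 2 μ) : ∫⁻ x, ‖f x‖ₑ ^ 2 ∂μ < ⊤ := by
  have := lintegral_rpow_enorm_lt_top_of_eLpNorm_lt_top (by norm_num) (by norm_num) hf.2
  simpa using this

theorem sum_three_sq_le (a : Fin 3 → ℝ≥0∞) : (∑ i, a i) ^ 2 ≤ 3 * ∑ i, a i ^ 2 := by
  have h := lintegral_sq_le (Measure.count : Measure (Fin 3)) (measurable_of_finite a).aemeasurable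
  simpa [lintegral_count, tsum_fintype] using h

theorem sum_three_pow_four_le (a : Fin 3 → ℝ≥0∞) : (∑ i, a i) ^ 4 ≤ 27 * ∑ i, a i ^ 4 := by
  have h := lintegral_pow_four_le (Measure.count : Measure (Fin 3))
    (measurable_of_finite a).aemeasurable
  have : (3 : ℝ≥0∞) ^ 3 = 27 := by norm_num
  simpa [lintegral_count, tsum_fintype, this] using h

theorem lintegral_gradSize_sq_le (hΩ : IsOpen Ω) {u : E3 → F} {g : Fin 3 → E3 → F}
    (hu : IsSobolev Ω u g) :
    ∫⁻ y, gradSize Ω g y ^ 2 ≤ 3 * ∑ i, ∫⁻ y in Ω, ‖g i y‖ₑ ^ 2 := by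
  have hm : ∀ i, AEMeasurable (fun y => ‖g i y‖ₑ ^ 2) (volume.restrict Ω) := fun i =>
    (hu.memLp_grad i).aestronglyMeasurable.enorm.pow_const 2
  rw [← lintegral_finsetSum' _ fun i _ => hm i, ← lintegral_const_mul' _ _ (by norm_num),
    ← lintegral_indicator hΩ.measurableSet]
  refine lintegral_mono fun y => ?_
  by_cases hy : y ∈ Ω
  · simpa [gradSize, hy] using sum_three_sq_le fun i => ‖g i y‖ₑ
  · simp [gradSize, hy]

theorem lintegral_gradSize_pow_four_le (hΩ : IsOpen Ω) {u : E3 → F} {g : Fin 3 → E3 → F}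
    (hu : IsSobolev Ω u g) :
    ∫⁻ y, gradSize Ω g y ^ 4 ≤ 27 * ∑ i, ∫⁻ y in Ω, ‖g i y‖ₑ ^ 4 := by
  have hm : ∀ i, AEMeasurable (fun y => ‖g i y‖ₑ ^ 4) (volume.restrict Ω) := fun i =>
    (hu.memLp_grad i).aestronglyMeasurable.enorm.pow_const 4
  rw [← lintegral_finsetSum' _ fun i _ => hm i, ← lintegral_const_mul' _ _ (by norm_num),
    ← lintegral_indicator hΩ.measurableSet]
  refine lintegral_mono fun y => ?_
  by_cases hy : y ∈ Ω
  · simpa [gradSize, hy] using sum_three_pow_four_le fun i => ‖g i y‖ₑ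
  · simp [gradSize, hy]

theorem lintegral_gradSize_sq_ne_top (hΩ : IsOpen Ω) {u : E3 → F} {g : Fin 3 → E3 → F}
    (hu : IsSobolev Ω u g) : ∫⁻ y, gradSize Ω g y ^ 2 ≠ ⊤ :=
  ne_top_of_le_ne_top (ENNReal.mul_ne_top (by norm_num)
    (ENNReal.sum_lt_top.2 fun i _ => lintegral_sq_lt_top (hu.memLp_grad i)).ne)
    (lintegral_gradSize_sq_le hΩ hu)

/-- A function is controlled by one of its cone means and a sum over scales of ball integrals
of its gradient. -/
theorem ae_enorm_le_tsum [CompleteSpace F] (hΩ : IsOpen Ω) (hΩb : Bornology.IsBounded Ω)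
    (hS : InnerCone Ω S e κ δ)
    (hφ : IsConeKernel e κ φ) {B : ℝ} (hB : 0 < B) (hφB : ∀ x, ‖φ x‖ ≤ B)
    {u : E3 → F} {g : Fin 3 → E3 → F} (hu : IsSobolev Ω u g) {b : ℝ} (hb : 0 < b)
    (hbδ : b ≤ δ) :
    ∀ᵐ x, x ∈ S → x ∈ Ω → ‖u x‖ₑ ≤ ‖coneMean Ω φ u x b‖ₑ +
      ∑' j : ℕ, ENNReal.ofReal (2 * B * 16 ^ 3 * (b / 16 ^ j)⁻¹ ^ 2) *
        ∫⁻ y in Metric.closedBall x (2 * (b / 16 ^ j)), gradSize Ω g y := by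
  have hfin : IsFiniteMeasure (volume.restrict Ω) :=
    ⟨by simpa using hΩb.measure_lt_top⟩
  filter_upwards [ae_tendsto_coneMean hΩ hS hφ (hu.memLp.integrable (by norm_num))] with x hx hxS hxΩ
  set f : ℕ → F := fun j => coneMean Ω φ u x (b / 16 ^ j) with hf
  set T : ℕ → ℝ≥0∞ := fun j => ENNReal.ofReal (2 * B * 16 ^ 3 * (b / 16 ^ j)⁻¹ ^ 2) *
        ∫⁻ y in Metric.closedBall x (2 * (b / 16 ^ j)), gradSize Ω g y
  have hpos : ∀ j : ℕ, 0 < b / 16 ^ j := fun j => by positivity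
  have hle : ∀ j : ℕ, b / 16 ^ j ≤ b := fun j => div_le_self hb.le (one_le_pow₀ (by norm_num))
  have hstep : ∀ j, edist (f j) (f (j + 1)) ≤ T j := by
    intro j
    have h := enorm_coneMean_sub_le hΩ hΩb hS hφ hB hφB hu hxS (hpos j) ((hle j).trans hbδ)
    rw [div_div, ← pow_succ] at h
    rwa [edist_eq_enorm_sub]
  have hlim : Tendsto f atTop (𝓝 (u x)) := by
    refine (hx hxS hxΩ).comp (tendsto_nhdsWithin_iff.2 ⟨?_, Eventually.of_forall hpos⟩)
    have : Tendsto (fun j : ℕ => b * (1 / 16 : ℝ) ^ j) atTop (𝓝 (b * 0)) :=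
      (tendsto_pow_atTop_nhds_zero_of_lt_one (by norm_num) (by norm_num)).const_mul b
    simpa [div_eq_mul_inv] using this
  have hdist : edist (f 0) (u x) ≤ ∑' j, T j :=
    edist_le_tsum_of_edist_le_of_tendsto₀ T hstep hlim
  have h0 : f 0 = coneMean Ω φ u x b := by simp [hf]
  calc ‖u x‖ₑ = edist (u x) 0 := (edist_zero_right _).symm
    _ ≤ edist (f 0) 0 + edist (f 0) (u x) := by
      rw [add_comm, edist_comm (f 0) (u x)]; exact edist_triangle _ _ _
    _ ≤ _ := by
      rw [edist_zero_right]
      exact add_le_add (by rw [h0]) hdist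

end Sobolev

end LLG

namespace LLG

open Filter Topology
open scoped ENNReal

/-! ### Local Sobolev estimates on a set with a uniform interior cone. -/

section Sobolev

variable {F : Type*} [NormedAddCommGroup F] [NormedSpace ℝ F]
variable {Ω S : Set E3} {e : E3} {κ δ : ℝ} {φ : E3 → ℝ}

theorem tsum_ofReal_div_two_pow {ρ : ℝ} (hρ : 0 ≤ ρ) :
    ∑' j : ℕ, ENNReal.ofReal (ρ / 2 ^ j) = 2 * ENNReal.ofReal ρ := by
  have h : ∀ j : ℕ, ENNReal.ofReal (ρ / 2 ^ j) = ENNReal.ofReal ρ * (2⁻¹ : ℝ≥0∞) ^ j := by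
    intro j
    rw [div_eq_mul_inv, ENNReal.ofReal_mul hρ, ENNReal.ofReal_inv_of_pos (by positivity),
      ENNReal.ofReal_pow (by norm_num), ENNReal.inv_pow]
    simp
  simp only [h]
  rw [ENNReal.tsum_mul_left, ENNReal.tsum_geometric, ENNReal.one_sub_inv_two, inv_inv, mul_comm]

/-- The powers ρ⁻³⁶ and (ρ¹²)³ cancel, so with this normalisation every scale contributes the same
amount and only the weights have to be summed. -/
theorem ofReal_scale_mul_volume {ρ : ℝ} (hρ : 0 < ρ) :
    ENNReal.ofReal (ρ⁻¹ ^ 9) ^ 4 * volume (Metric.closedBall (0 : E3) (2 * ρ ^ 4)) ^ 3 =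
      volume (Metric.closedBall (0 : E3) 2) ^ 3 := by
  rw [volume_closedBall_two_mul _ (by positivity), mul_pow, ← mul_assoc,
    ← ENNReal.ofReal_pow (by positivity), ← ENNReal.ofReal_pow (by positivity),
    ← ENNReal.ofReal_mul (by positivity)]
  have : (ρ⁻¹ ^ 9) ^ 4 * ((ρ ^ 4) ^ 3) ^ 3 = 1 := by
    field_simp
  rw [this, ENNReal.ofReal_one, one_mul]

/-- Start the telescoping at radius ρ⁴. In dimension three both estimates gain a factor radius^{1/4}
per scale, hence ρ ^ 4 in front of the gradient after raising to the fourth power. The constant `D`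
is chosen before ρ, so shrinking ρ makes the gradient term small at the cost of `C`. -/
theorem exists_local_embedding [CompleteSpace F] (hΩ : IsOpen Ω) (hΩb : Bornology.IsBounded Ω)
    (hS : InnerCone Ω S e κ δ) (hSm : MeasurableSet S) (hSΩ : S ⊆ Ω) :
    ∃ D : ℝ≥0∞, D ≠ ⊤ ∧ ∀ ρ : ℝ, 0 < ρ → ρ ^ 4 ≤ δ → ∃ C : ℝ≥0∞, C ≠ ⊤ ∧
      ∀ (u : E3 → F) (g : Fin 3 → E3 → F), IsSobolev Ω u g →
        (∫⁻ x in S, ‖u x‖ₑ ^ 4 ≤ C * (∫⁻ x in Ω, ‖u x‖ₑ ^ 2) ^ 2 +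
          D * ENNReal.ofReal ρ ^ 4 * (∫⁻ x, gradSize Ω g x ^ 2) ^ 2) ∧
        ∀ᵐ x ∂volume.restrict S, ‖u x‖ₑ ^ 4 ≤ C * (∫⁻ x in Ω, ‖u x‖ₑ ^ 2) ^ 2 +
          D * ENNReal.ofReal ρ ^ 4 * ∫⁻ x, gradSize Ω g x ^ 4 := by
  obtain ⟨φ, hφ⟩ := exists_isConeKernel e hS.aperture_pos
  obtain ⟨B, hB, hφB, -⟩ := hφ.exists_bound
  set V := volume (Metric.closedBall (0 : E3) 2)
  have hV : V ≠ ⊤ := measure_closedBall_lt_top.ne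
  have hΩt : volume Ω ≠ ⊤ := hΩb.measure_lt_top.ne
  set D₀ : ℝ := 2 * B * 16 ^ 3
  -- The outer 16 comes from (a + b)⁴ ≤ 16 (a⁴ + b⁴). The inner one is 2³ · 2: the sum of the
  -- weights, 2ρ, enters cubed through Jensen and once more when the bound is summed over scales.
  refine ⟨16 * (16 * ENNReal.ofReal D₀ ^ 4 * V ^ 3), by finiteness, fun ρ hρ hρδ => ?_⟩
  set E : ℝ≥0∞ := 16 * (ENNReal.ofReal ((ρ ^ 4)⁻¹ ^ 3 * B) ^ 4 * volume Ω ^ 2)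
  have hE : E ≠ ⊤ := by finiteness
  -- `E` serves the pointwise estimate, `E * volume Ω` the integrated one.
  refine ⟨E + E * volume Ω, by finiteness, fun u g hu => ?_⟩
  set N := (∫⁻ x in Ω, ‖u x‖ₑ ^ 2) ^ 2
  -- The radii ρ⁴/16ʲ are fourth powers of ρⱼ = ρ/2ʲ. The factor (ρⱼ⁴)⁻² of the telescoping estimate
  -- is split as ρⱼ · ρⱼ⁻⁹: a summable weight, and a factor adapted to the ball volume.
  set w : ℕ → ℝ≥0∞ := fun j => ENNReal.ofReal (ρ / 2 ^ j) with hw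
  set c : ℕ → E3 → ℝ≥0∞ := fun j x => ENNReal.ofReal ((ρ / 2 ^ j)⁻¹ ^ 9) *
    ∫⁻ y in Metric.closedBall x (2 * (ρ / 2 ^ j) ^ 4), gradSize Ω g y with hc
  have hpos : ∀ j : ℕ, 0 < ρ / 2 ^ j := fun j => by positivity
  have hG := aemeasurable_gradSize hΩ hu
  have hsumw : ∑' j, w j = 2 * ENNReal.ofReal ρ := tsum_ofReal_div_two_pow hρ.le
  have hmean : ∀ x, 16 * ‖coneMean Ω φ u x (ρ ^ 4)‖ₑ ^ 4 ≤ E * N := by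
    intro x
    have h1 := enorm_coneMean_le (Ω := Ω) hφB u x (show 0 < ρ ^ 4 by positivity)
    have h2 := lintegral_sq_le (volume.restrict Ω) hu.memLp.aestronglyMeasurable.enorm
    rw [Measure.restrict_apply_univ] at h2
    calc _ ≤ 16 * (ENNReal.ofReal ((ρ ^ 4)⁻¹ ^ 3 * B) * ∫⁻ y in Ω, ‖u y‖ₑ) ^ 4 := by gcongr
      _ = 16 * (ENNReal.ofReal ((ρ ^ 4)⁻¹ ^ 3 * B) ^ 4 * ((∫⁻ y in Ω, ‖u y‖ₑ) ^ 2) ^ 2) := by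
        rw [mul_pow, ← pow_mul]
      _ ≤ 16 * (ENNReal.ofReal ((ρ ^ 4)⁻¹ ^ 3 * B) ^ 4 *
          (volume Ω * ∫⁻ y in Ω, ‖u y‖ₑ ^ 2) ^ 2) := by gcongr
      _ = _ := by rw [mul_pow]; ring
  have hpt : ∀ᵐ x ∂volume.restrict S, ‖u x‖ₑ ^ 4 ≤ E * N +
      16 * (ENNReal.ofReal D₀ ^ 4 * (2 * ENNReal.ofReal ρ) ^ 3 * ∑' j, w j * c j x ^ 4) := by
    filter_upwards [ae_restrict_of_ae (ae_enorm_le_tsum hΩ hΩb hS hφ hB hφB hu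
      (show 0 < ρ ^ 4 by positivity) hρδ), ae_restrict_mem hSm] with x hx hxS
    have hterm : ∀ j : ℕ, ENNReal.ofReal (2 * B * 16 ^ 3 * (ρ ^ 4 / 16 ^ j)⁻¹ ^ 2) *
        ∫⁻ y in Metric.closedBall x (2 * (ρ ^ 4 / 16 ^ j)), gradSize Ω g y =
        ENNReal.ofReal D₀ * (w j * c j x) := by
      intro j
      have h4 : ρ ^ 4 / 16 ^ j = (ρ / 2 ^ j) ^ 4 := by
        rw [div_pow, ← pow_mul, mul_comm j 4, pow_mul]; norm_num
      rw [h4, hw, hc]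
      dsimp only
      rw [← mul_assoc, ← mul_assoc, ← ENNReal.ofReal_mul (by positivity),
        ← ENNReal.ofReal_mul (by positivity)]
      congr 2
      simp only [D₀]
      have := hpos j
      field_simp
    have h := hx hxS (hSΩ hxS)
    simp only [hterm] at h
    rw [ENNReal.tsum_mul_left] at h
    calc ‖u x‖ₑ ^ 4 ≤ (‖coneMean Ω φ u x (ρ ^ 4)‖ₑ +
          ENNReal.ofReal D₀ * ∑' j, w j * c j x) ^ 4 := by gcongr
      _ ≤ 16 * (‖coneMean Ω φ u x (ρ ^ 4)‖ₑ ^ 4 +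
          (ENNReal.ofReal D₀ * ∑' j, w j * c j x) ^ 4) := ennreal_add_pow_four_le _ _
      _ = 16 * ‖coneMean Ω φ u x (ρ ^ 4)‖ₑ ^ 4 +
          16 * (ENNReal.ofReal D₀ ^ 4 * (∑' j, w j * c j x) ^ 4) := by rw [mul_add, mul_pow]
      _ ≤ E * N + 16 * (ENNReal.ofReal D₀ ^ 4 *
          ((2 * ENNReal.ofReal ρ) ^ 3 * ∑' j, w j * c j x ^ 4)) := by
          have := tsum_mul_pow_four_le w (fun j => c j x)
          rw [hsumw] at this
          refine add_le_add (hmean x) ?_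
          gcongr
      _ = _ := by rw [mul_assoc (ENNReal.ofReal D₀ ^ 4)]
  have hcomb : ∀ X : ℝ≥0∞, 16 * (ENNReal.ofReal D₀ ^ 4 * (2 * ENNReal.ofReal ρ) ^ 3 *
      (2 * ENNReal.ofReal ρ * (V ^ 3 * X))) =
      16 * (16 * ENNReal.ofReal D₀ ^ 4 * V ^ 3) * ENNReal.ofReal ρ ^ 4 * X := by
    intro X; ring
  constructor
  · have hcm : ∀ j, AEMeasurable (fun x => c j x ^ 4) := fun j =>
      ((aemeasurable_lintegral_closedBall hG _).const_mul _).pow_const 4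
    calc ∫⁻ x in S, ‖u x‖ₑ ^ 4 ≤ ∫⁻ x in S, (E * N + 16 * (ENNReal.ofReal D₀ ^ 4 *
          (2 * ENNReal.ofReal ρ) ^ 3 * ∑' j, w j * c j x ^ 4)) := lintegral_mono_ae hpt
      _ = E * N * volume S + 16 * (ENNReal.ofReal D₀ ^ 4 *
          (2 * ENNReal.ofReal ρ) ^ 3 * ∑' j, w j * ∫⁻ x in S, c j x ^ 4) := by
          rw [lintegral_add_left measurable_const, lintegral_const, Measure.restrict_apply_univ,
            lintegral_const_mul' _ _ (by norm_num), lintegral_const_mul' _ _ (by finiteness),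
            lintegral_tsum fun j => (hcm j).restrict.const_mul _]
          congr 5
          ext j
          exact lintegral_const_mul' _ _ ENNReal.ofReal_ne_top
      _ ≤ E * N * volume Ω + 16 * (ENNReal.ofReal D₀ ^ 4 *
          (2 * ENNReal.ofReal ρ) ^ 3 * ∑' j, w j *
            (V ^ 3 * (∫⁻ x, gradSize Ω g x ^ 2) ^ 2)) := by
          gcongr with j
          refine (setLIntegral_le_lintegral _ _).trans ?_
          simp only [hc, mul_pow]
          rw [lintegral_const_mul' _ _ (by finiteness)]
          refine (mul_le_mul_right (lintegral_lintegral_closedBall_pow_four_le hG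
            (lintegral_gradSize_sq_ne_top hΩ hu) _) _).trans ?_
          rw [← mul_assoc, ofReal_scale_mul_volume (hpos j)]
      _ = E * volume Ω * N + 16 * (16 * ENNReal.ofReal D₀ ^ 4 * V ^ 3) * ENNReal.ofReal ρ ^ 4 *
          (∫⁻ x, gradSize Ω g x ^ 2) ^ 2 := by
          rw [ENNReal.tsum_mul_right, hsumw, hcomb, mul_right_comm]
      _ ≤ _ := by
          gcongr
          exact le_add_self
  · filter_upwards [hpt] with x hx
    calc _ ≤ _ := hx
      _ ≤ E * N + 16 * (ENNReal.ofReal D₀ ^ 4 *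
          (2 * ENNReal.ofReal ρ) ^ 3 * ∑' j, w j *
            (V ^ 3 * ∫⁻ x, gradSize Ω g x ^ 4)) := by
          gcongr with j
          simp only [hc, mul_pow]
          refine (mul_le_mul_right (lintegral_closedBall_pow_four_le hG x _) _).trans ?_
          rw [← mul_assoc, ofReal_scale_mul_volume (hpos j)]
      _ = E * N + 16 * (16 * ENNReal.ofReal D₀ ^ 4 * V ^ 3) * ENNReal.ofReal ρ ^ 4 *
          ∫⁻ x, gradSize Ω g x ^ 4 := by
          rw [ENNReal.tsum_mul_right, hsumw, hcomb]
      _ ≤ _ := by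
          gcongr
          exact le_self_add

end Sobolev

end LLG

/-! ### Sobolev estimates on the whole domain, by the cone property and compactness. -/

namespace LLG

open Filter Topology
open scoped ENNReal

/-- The Sobolev-type estimates on the part `S` of the domain `Ω`: the embedding `H¹ ⊂ L⁴` with
arbitrarily small constant in front of the gradient, and the embedding `W^{1,4} ⊂ L^∞`. -/
structure EmbedsOn (F : Type*) [NormedAddCommGroup F] [NormedSpace ℝ F] (Ω S : Set E3) : Prop where
  four : ∀ ε : ℝ≥0∞, ε ≠ 0 → ∃ C : ℝ≥0∞, C ≠ ⊤ ∧
    ∀ (u : E3 → F) (g : Fin 3 → E3 → F), IsSobolev Ω u g →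
      ∫⁻ x in S, ‖u x‖ₑ ^ 4 ≤ C * (∫⁻ x in Ω, ‖u x‖ₑ ^ 2) ^ 2 +
        ε * (∫⁻ x, gradSize Ω g x ^ 2) ^ 2
  top : ∃ C : ℝ≥0∞, C ≠ ⊤ ∧
    ∀ (u : E3 → F) (g : Fin 3 → E3 → F), IsSobolev Ω u g →
      ∀ᵐ x ∂volume.restrict S, ‖u x‖ₑ ^ 4 ≤ C * ((∫⁻ x in Ω, ‖u x‖ₑ ^ 2) ^ 2 +
        ∫⁻ x, gradSize Ω g x ^ 4)

section Sobolev

variable {F : Type*} [NormedAddCommGroup F] [NormedSpace ℝ F]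
variable {Ω S : Set E3} {e : E3} {κ δ : ℝ} {φ : E3 → ℝ}

/-- Choose ρ so small that `D * ρ ^ 4` is below ε; for the L^∞ bound any admissible ρ will do. -/
theorem InnerCone.embedsOn [CompleteSpace F] (hΩ : IsOpen Ω) (hΩb : Bornology.IsBounded Ω)
    (hS : InnerCone Ω S e κ δ) (hSm : MeasurableSet S) (hSΩ : S ⊆ Ω) : EmbedsOn F Ω S := by
  obtain ⟨D, hD, hDρ⟩ := exists_local_embedding (F := F) hΩ hΩb hS hSm hSΩ
  have hsmall : ∀ a : ℝ, 0 < a → ∃ ρ : ℝ, 0 < ρ ∧ ρ ^ 4 ≤ δ ∧ ρ ^ 4 ≤ a := by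
    intro a ha
    have hm : 0 < min 1 (min δ a) := lt_min one_pos (lt_min hS.height_pos ha)
    have hp : min 1 (min δ a) ^ 4 ≤ min 1 (min δ a) :=
      pow_le_of_le_one hm.le (min_le_left _ _) (by norm_num)
    exact ⟨_, hm, hp.trans ((min_le_right _ _).trans (min_le_left _ _)),
      hp.trans ((min_le_right _ _).trans (min_le_right _ _))⟩
  constructor
  · intro ε hε
    obtain ⟨a, ha, haε⟩ : ∃ a : ℝ, 0 < a ∧ D * ENNReal.ofReal a ≤ ε := by
      have ht : Tendsto (fun a : ℝ => D * ENNReal.ofReal a) (𝓝[>] 0) (𝓝 0) := by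
        have h1 : Tendsto (fun a : ℝ => ENNReal.ofReal a) (𝓝[>] 0) (𝓝 0) := by
          have := (ENNReal.continuous_ofReal.tendsto 0).mono_left
            (nhdsWithin_le_nhds (s := Ioi 0))
          simpa using this
        simpa using ENNReal.Tendsto.const_mul h1 (Or.inr hD)
      have h2 := (ht.eventually (ge_mem_nhds (pos_iff_ne_zero.2 hε))).and self_mem_nhdsWithin
      obtain ⟨a, ha1, ha2⟩ := h2.exists
      exact ⟨a, ha2, ha1⟩
    obtain ⟨ρ, hρ, hρδ, hρa⟩ := hsmall a ha
    obtain ⟨C, hC, h⟩ := hDρ ρ hρ hρδ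
    refine ⟨C, hC, fun u g hu => ((h u g hu).1).trans ?_⟩
    gcongr
    refine le_trans ?_ haε
    rw [← ENNReal.ofReal_pow hρ.le]
    gcongr
  · obtain ⟨ρ, hρ, hρδ, -⟩ := hsmall 1 one_pos
    obtain ⟨C, hC, h⟩ := hDρ ρ hρ hρδ
    refine ⟨C + D * ENNReal.ofReal ρ ^ 4, by finiteness, fun u g hu => ?_⟩
    filter_upwards [(h u g hu).2] with x hx
    refine hx.trans ?_
    rw [mul_add]
    gcongr
    · exact le_self_add
    · exact le_add_self

theorem EmbedsOn.empty : EmbedsOn F Ω ∅ :=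
  ⟨fun _ _ => ⟨0, by simp, by simp⟩, ⟨0, by simp, by simp⟩⟩

theorem EmbedsOn.mono {S' : Set E3} (h : EmbedsOn F Ω S') (hS : S ⊆ S') : EmbedsOn F Ω S := by
  refine ⟨fun ε hε => ?_, ?_⟩
  · obtain ⟨C, hC, hC'⟩ := h.four ε hε
    exact ⟨C, hC, fun u g hu => (lintegral_mono_set hS).trans (hC' u g hu)⟩
  · obtain ⟨C, hC, hC'⟩ := h.top
    exact ⟨C, hC, fun u g hu => ae_restrict_of_ae_restrict_of_subset hS (hC' u g hu)⟩

theorem EmbedsOn.union {S' : Set E3} (h : EmbedsOn F Ω S) (h' : EmbedsOn F Ω S') :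
    EmbedsOn F Ω (S ∪ S') := by
  refine ⟨fun ε hε => ?_, ?_⟩
  · obtain ⟨C, hC, hC'⟩ := h.four (ε / 2) (by simpa using hε)
    obtain ⟨D, hD, hD'⟩ := h'.four (ε / 2) (by simpa using hε)
    refine ⟨C + D, by finiteness, fun u g hu => ?_⟩
    refine (lintegral_union_le _ _ _).trans ((add_le_add (hC' u g hu) (hD' u g hu)).trans ?_)
    rw [add_add_add_comm, ← add_mul, ← add_mul, ENNReal.add_halves]
  · obtain ⟨C, hC, hC'⟩ := h.top
    obtain ⟨D, hD, hD'⟩ := h'.top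
    refine ⟨C + D, by finiteness, fun u g hu => ?_⟩
    rw [ae_restrict_union_iff]
    constructor
    · filter_upwards [hC' u g hu] with x hx
      refine hx.trans ?_
      gcongr
      exact le_self_add
    · filter_upwards [hD' u g hu] with x hx
      refine hx.trans ?_
      gcongr
      exact le_add_self

/-- Every point of the closure of a `C^{2,1}` domain has a ball around it in which the domain has
the interior cone property. -/
theorem IsBoundedC21Domain.exists_innerCone (hΩ : IsBoundedC21Domain Ω) {x : E3}
    (hx : x ∈ closure Ω) :
    ∃ r > 0, ∃ e κ δ, InnerCone Ω (Metric.ball x r ∩ Ω) e κ δ := by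
  by_cases hxΩ : x ∈ Ω
  · obtain ⟨r, hr, hball⟩ := Metric.isOpen_iff.1 hΩ.isOpen x hxΩ
    refine ⟨r / 2, by positivity, 0, 1, r / 2, ⟨by simp, one_pos, le_rfl, by positivity, ?_⟩⟩
    intro y hy s hs hs' ζ hζ
    apply hball
    rw [sub_zero] at hζ
    have h1 : ‖y - x‖ < r / 2 := mem_ball_iff_norm.1 hy.1
    have h2 : ‖s • ζ‖ ≤ r / 2 := by
      rw [norm_smul, Real.norm_of_nonneg hs.le]
      calc s * ‖ζ‖ ≤ r / 2 * 1 := by gcongr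
        _ = r / 2 := mul_one _
    rw [mem_ball_iff_norm]
    calc ‖y + s • ζ - x‖ = ‖(y - x) + s • ζ‖ := by congr 1; abel
      _ ≤ ‖y - x‖ + ‖s • ζ‖ := norm_add_le _ _
      _ < r := by linarith
  · have hfr : x ∈ frontier Ω := by
      rw [frontier, hΩ.isOpen.interior_eq]; exact ⟨hx, hxΩ⟩
    obtain ⟨r, hr, Φ, γ, -, hγ, hgraph⟩ := hΩ.graph x hfr
    -- Order zero: the graph function itself is Lipschitz, which is all the cone condition needs.
    obtain ⟨K, hK⟩ := hγ 0 (by norm_num)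
    have hγL : ∀ a b, |γ a - γ b| ≤ K * ‖a - b‖ := by
      intro a b
      have := hK.dist_le_mul a b
      rw [dist_eq_norm, dist_eq_norm] at this
      have h0 : iteratedFDeriv ℝ 0 γ a - iteratedFDeriv ℝ 0 γ b =
          iteratedFDeriv ℝ 0 (fun _ : EuclideanSpace ℝ (Fin 2) => γ a - γ b) a := by
        ext; simp
      rwa [h0, norm_iteratedFDeriv_zero] at this
    -- By Mazur-Ulam the surjective isometry Φ is affine; L is its linear part.
    set L : E3 ≃ₗᵢ[ℝ] E3 := Φ.toRealAffineIsometryEquiv.linearIsometryEquiv with hL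
    have hΦ : ∀ y z, Φ (y + z) = Φ y + L z := by
      intro y z
      have := Φ.toRealAffineIsometryEquiv.map_vadd y z
      simp only [vadd_eq_add, IsometryEquiv.coeFn_toRealAffineIsometryEquiv] at this
      rw [add_comm y z, this, add_comm]
    set e : E3 := L.symm (unitVec 2)
    have hLe : L e = unitVec 2 := L.apply_symm_apply _
    -- With K κ = 1 - κ, a direction within κ of the vertical rises by at least 1 - κ, while the
    -- graph over its horizontal part rises by at most K κ. The cone therefore stays above the
    -- graph.
    set κ : ℝ := (1 + K : ℝ)⁻¹ with hκ
    have hK0 : (0 : ℝ) ≤ K := K.2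
    have hκ0 : 0 < κ := by positivity
    have hκ1 : κ ≤ 1 := inv_le_one_of_one_le₀ (by linarith)
    have hκK : K * κ = 1 - κ := by rw [hκ]; field_simp; ring
    have he1 : ‖e‖ = 1 := by simp [e, unitVec]
    -- Directions have norm at most 2, so height r/4 moves a point of the half ball by at most r/2
    -- and stays inside the chart.
    refine ⟨r / 2, by positivity, e, κ, r / 4, ⟨he1.le, hκ0, hκ1, by positivity, ?_⟩⟩
    intro y hy s hs hs' ζ hζ
    have h1 : ‖y - x‖ < r / 2 := mem_ball_iff_norm.1 hy.1
    have hζ2 : ‖ζ‖ ≤ 2 := by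
      have := norm_sub_norm_le ζ e
      linarith
    have h2 : ‖s • ζ‖ ≤ r / 2 := by
      rw [norm_smul, Real.norm_of_nonneg hs.le]
      calc s * ‖ζ‖ ≤ r / 4 * 2 := by gcongr
        _ = r / 2 := by ring
    have hmem : y + s • ζ ∈ Metric.ball x r := by
      rw [mem_ball_iff_norm]
      calc ‖y + s • ζ - x‖ = ‖(y - x) + s • ζ‖ := by congr 1; abel
        _ ≤ ‖y - x‖ + ‖s • ζ‖ := norm_add_le _ _
        _ < r := by linarith
    have hyball : y ∈ Metric.ball x r := Metric.ball_subset_ball (by linarith) hy.1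
    rw [hgraph _ hmem, hΦ, map_smul]
    have hyγ := (hgraph y hyball).1 hy.2
    set w : E3 := L ζ
    have hw : ‖w - unitVec 2‖ ≤ κ := by
      rw [← hLe, ← map_sub, L.norm_map]; exact hζ
    have hw2 : 1 - κ ≤ w 2 := by
      have h := (PiLp.norm_apply_le (w - unitVec 2) 2).trans hw
      have h' : (w - unitVec 2) 2 = w 2 - 1 := by simp [unitVec]
      rw [h', Real.norm_eq_abs] at h
      linarith [(abs_le.1 h).1]
    have hw01 : ‖!₂[w 0, w 1]‖ ≤ κ := by
      refine le_trans ?_ hw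
      rw [EuclideanSpace.norm_eq, EuclideanSpace.norm_eq]
      apply Real.sqrt_le_sqrt
      simp [Fin.sum_univ_two, Fin.sum_univ_three, unitVec]
      positivity
    have hlip := hγL !₂[(Φ y + s • w) 0, (Φ y + s • w) 1] !₂[Φ y 0, Φ y 1]
    have hdiff : !₂[(Φ y + s • w) 0, (Φ y + s • w) 1] - !₂[Φ y 0, Φ y 1] = s • !₂[w 0, w 1] := by
      ext i
      fin_cases i <;> simp
    rw [hdiff, norm_smul, Real.norm_of_nonneg hs.le] at hlip
    have h3 : (K : ℝ) * (s * ‖!₂[w 0, w 1]‖) ≤ s * (1 - κ) := by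
      rw [← hκK]
      calc (K : ℝ) * (s * ‖!₂[w 0, w 1]‖) ≤ K * (s * κ) := by gcongr
        _ = _ := by ring
    have h4 : s * (1 - κ) ≤ s * w 2 := by gcongr
    have h5 : (Φ y + s • w) 2 = Φ y 2 + s * w 2 := by simp
    rw [h5]
    linarith [(abs_le.1 hlip).2]

theorem IsBoundedC21Domain.embedsOn [CompleteSpace F] (hΩ : IsBoundedC21Domain Ω) :
    EmbedsOn F Ω Ω := by
  have hcpt : IsCompact (closure Ω) := hΩ.isBounded.isCompact_closure
  have h : EmbedsOn F Ω (closure Ω ∩ Ω) := by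
    refine hcpt.induction_on (p := fun S => EmbedsOn F Ω (S ∩ Ω)) ?_ ?_ ?_ ?_
    · rw [empty_inter]; exact EmbedsOn.empty
    · exact fun s t hst h => h.mono (inter_subset_inter_left _ hst)
    · intro s t hs ht
      rw [union_inter_distrib_right]
      exact hs.union ht
    · intro x hx
      obtain ⟨r, hr, e, κ, δ, hS⟩ := hΩ.exists_innerCone hx
      exact ⟨Metric.ball x r, mem_nhdsWithin_of_mem_nhds (Metric.ball_mem_nhds x hr),
        hS.embedsOn hΩ.isOpen hΩ.isBounded
          (Metric.isOpen_ball.inter hΩ.isOpen).measurableSet inter_subset_right⟩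
  exact h.mono fun x hx => ⟨subset_closure hx, hx⟩

end Sobolev

end LLG

namespace LLG

open Filter Topology ContinuousLinearMap
open scoped ENNReal Convolution

/-! ### Mollification: convergence in L¹ and commutation with weak derivatives. -/

section Mollify

variable {F : Type*} [NormedAddCommGroup F] [NormedSpace ℝ F]

theorem norm_convolution_le_convolution_norm {f : E3 → ℝ} (hf : ∀ x, 0 ≤ f x) (w : E3 → F)
    (x : E3) : ‖(f ⋆[lsmul ℝ ℝ, volume] w) x‖ ≤ (f ⋆[lsmul ℝ ℝ, volume] fun y => ‖w y‖) x := by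
  refine (norm_integral_le_integral_norm _).trans_eq (integral_congr_ae ?_)
  refine Eventually.of_forall fun t => ?_
  simp [norm_smul, abs_of_nonneg (hf t)]

/-- Mollifications of an integrable function converge in mean. -/
theorem tendsto_integral_norm_convolution_sub [CompleteSpace F] (f : ℕ → ContDiffBump (0 : E3))
    {K : ℝ} (hf : Tendsto (fun n => (f n).rOut) atTop (𝓝 0))
    (hK : ∀ n, (f n).rOut ≤ K * (f n).rIn) {w : E3 → F} (hw : Integrable w) :
    Tendsto (fun n => ∫ x, ‖((f n).normed volume ⋆[lsmul ℝ ℝ, volume] w) x - w x‖)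
      atTop (𝓝 0) := by
  have hρ : ∀ n, Integrable ((f n).normed volume) := fun n => (f n).integrable_normed
  set c : ℕ → E3 → F := fun n => (f n).normed volume ⋆[lsmul ℝ ℝ, volume] w with hc
  set b : ℕ → E3 → ℝ := fun n => (f n).normed volume ⋆[lsmul ℝ ℝ, volume] fun y => ‖w y‖ with hb
  have hci : ∀ n, Integrable (c n) := fun n => (hρ n).integrable_convolution _ hw
  have hbi : ∀ n, Integrable (b n) := fun n => (hρ n).integrable_convolution _ hw.norm
  have hbint : ∀ n, ∫ x, b n x = ∫ x, ‖w x‖ := by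
    intro n
    simp only [hb]
    rw [integral_convolution _ (hρ n) hw.norm, (f n).integral_normed]
    simp
  have hcb : ∀ n x, ‖c n x‖ ≤ b n x := fun n x =>
    norm_convolution_le_convolution_norm (f n).nonneg_normed w x
  have hcl : ∀ᵐ x, Tendsto (fun n => c n x) atTop (𝓝 (w x)) :=
    ContDiffBump.ae_convolution_tendsto_right_of_locallyIntegrable hf (Eventually.of_forall hK)
      hw.locallyIntegrable
  have hbl : ∀ᵐ x, Tendsto (fun n => b n x) atTop (𝓝 ‖w x‖) :=
    ContDiffBump.ae_convolution_tendsto_right_of_locallyIntegrable hf (Eventually.of_forall hK)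
      hw.norm.locallyIntegrable
  have h1 : Tendsto (fun n => ∫ x, min (b n x) ‖w x‖) atTop (𝓝 (∫ x, ‖w x‖)) := by
    refine tendsto_integral_of_dominated_convergence (fun x => ‖w x‖)
      (fun n => ((hbi n).inf hw.norm).aestronglyMeasurable) hw.norm ?_ ?_
    · refine fun n => Eventually.of_forall fun x => ?_
      have h0 : 0 ≤ b n x := (norm_nonneg _).trans (hcb n x)
      rw [Real.norm_of_nonneg (le_min h0 (norm_nonneg _))]
      exact min_le_right _ _
    · filter_upwards [hbl] with x hx
      simpa using hx.min (tendsto_const_nhds (x := ‖w x‖))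
  have h2 : Tendsto (fun n => ∫ x, min ‖c n x - w x‖ (2 * ‖w x‖)) atTop (𝓝 (∫ _ : E3, (0 : ℝ))) := by
    refine tendsto_integral_of_dominated_convergence (fun x => 2 * ‖w x‖)
      (fun n => (((hci n).sub hw).norm.inf (hw.norm.const_mul 2)).aestronglyMeasurable)
      (hw.norm.const_mul 2) ?_ ?_
    · refine fun n => Eventually.of_forall fun x => ?_
      rw [Real.norm_of_nonneg (by positivity)]
      exact min_le_right _ _
    · filter_upwards [hcl] with x hx
      have h0 := (tendsto_iff_norm_sub_tendsto_zero.1 hx).min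
        (tendsto_const_nhds (x := 2 * ‖w x‖))
      rwa [min_eq_left (by positivity)] at h0
  -- A Scheffé argument: ‖c - w‖ ≤ min(‖c - w‖, 2‖w‖) + (b - min(b, ‖w‖)). The first part is
  -- dominated by 2‖w‖; the second has integral ∫ ‖w‖ - ∫ min(b, ‖w‖), since mollifying preserves
  -- the integral of ‖w‖.
  have h3 : Tendsto (fun n => (∫ x, min ‖c n x - w x‖ (2 * ‖w x‖)) +
      ((∫ x, ‖w x‖) - ∫ x, min (b n x) ‖w x‖)) atTop (𝓝 0) := by
    have := h2.add (h1.const_sub (∫ x, ‖w x‖))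
    simpa using this
  refine squeeze_zero (fun n => integral_nonneg fun x => norm_nonneg _) (fun n => ?_) h3
  have hi1 : Integrable fun x => min ‖c n x - w x‖ (2 * ‖w x‖) :=
    ((hci n).sub hw).norm.inf (hw.norm.const_mul 2)
  have hi2 : Integrable fun x => min (b n x) ‖w x‖ := (hbi n).inf hw.norm
  have hi3 : Integrable fun x => b n x - min (b n x) ‖w x‖ := (hbi n).sub hi2
  rw [← hbint n, ← integral_sub (hbi n) hi2, ← integral_add hi1 hi3]
  refine integral_mono ((hci n).sub hw).norm (hi1.add hi3) fun x => ?_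
  have hle : ‖c n x - w x‖ ≤ b n x + ‖w x‖ := (norm_sub_le _ _).trans (by gcongr; exact hcb n x)
  dsimp only
  rcases le_total (b n x) ‖w x‖ with h | h
  · rw [min_eq_left h, min_eq_left (by linarith), sub_self, add_zero]
  · rw [min_eq_right h]
    rcases le_total ‖c n x - w x‖ (2 * ‖w x‖) with h' | h'
    · rw [min_eq_left h']; linarith
    · rw [min_eq_right h']; linarith

/-- Convergence of integrals of a product of a bounded and an `L¹`-convergent sequence. -/
theorem tendsto_integral_clm_apply {E : Type*} [NormedAddCommGroup E] [NormedSpace ℝ E]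
    {A : ℕ → E3 → E →L[ℝ] F} {A₀ : E3 → E →L[ℝ] F} {C : ℝ}
    (hA : ∀ n, AEStronglyMeasurable (A n))
    (hC : ∀ n, ∀ᵐ x, ‖A n x‖ ≤ C) (hlim : ∀ᵐ x, Tendsto (fun n => A n x) atTop (𝓝 (A₀ x)))
    {w : ℕ → E3 → E} {w₀ : E3 → E} (hw : ∀ n, Integrable (w n)) (hw₀ : Integrable w₀)
    (hwlim : Tendsto (fun n => ∫ x, ‖w n x - w₀ x‖) atTop (𝓝 0)) :
    Tendsto (fun n => ∫ x, A n x (w n x)) atTop (𝓝 (∫ x, A₀ x (w₀ x))) := by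
  have hmeas : ∀ {B : E3 → E →L[ℝ] F} {v : E3 → E}, AEStronglyMeasurable B →
      AEStronglyMeasurable v → AEStronglyMeasurable fun x => B x (v x) := fun hB hv =>
    (ContinuousLinearMap.id ℝ (E →L[ℝ] F)).aestronglyMeasurable_comp₂ hB hv
  have hint : ∀ n (v : E3 → E), Integrable v → Integrable fun x => A n x (v x) := by
    intro n v hv
    refine (hv.norm.const_mul C).mono' (hmeas (hA n) hv.aestronglyMeasurable) ?_
    filter_upwards [hC n] with x hx
    exact (le_opNorm _ _).trans (by gcongr)
  have h1 : Tendsto (fun n => ∫ x, A n x (w₀ x)) atTop (𝓝 (∫ x, A₀ x (w₀ x))) := by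
    refine tendsto_integral_of_dominated_convergence (fun x => C * ‖w₀ x‖)
      (fun n => (hint n w₀ hw₀).aestronglyMeasurable) (hw₀.norm.const_mul C) ?_ ?_
    · intro n
      filter_upwards [hC n] with x hx
      exact (le_opNorm _ _).trans (by gcongr)
    · filter_upwards [hlim] with x hx
      exact (ContinuousLinearMap.apply ℝ F (w₀ x)).continuous.continuousAt.tendsto.comp hx
  have h2 : Tendsto (fun n => (∫ x, A n x (w n x)) - ∫ x, A n x (w₀ x)) atTop (𝓝 0) := by
    refine squeeze_zero_norm (fun n => ?_) (by simpa using hwlim.const_mul C)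
    rw [← integral_sub (hint n _ (hw n)) (hint n _ hw₀), ← integral_const_mul]
    refine norm_integral_le_of_norm_le (((hw n).sub hw₀).norm.const_mul C) ?_
    filter_upwards [hC n] with x hx
    rw [← map_sub]
    exact (le_opNorm _ _).trans (by gcongr)
  simpa using h2.add h1

/-- The derivative of a mollification is the mollification of the weak derivative. -/
theorem fderiv_convolution_eq [CompleteSpace F] {Ω : Set E3} (hΩ : IsOpen Ω) {u v : E3 → F}
    {i : Fin 3} (hu : Integrable u (volume.restrict Ω)) (huv : IsWeakPartial Ω i u v)
    (f : ContDiffBump (0 : E3)) {x : E3} (hx : Metric.closedBall x f.rOut ⊆ Ω) :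
    fderiv ℝ (f.normed volume ⋆[lsmul ℝ ℝ, volume] Ω.indicator u) x (unitVec i) =
      (f.normed volume ⋆[lsmul ℝ ℝ, volume] Ω.indicator v) x := by
  set ρ : E3 → ℝ := f.normed volume with hρ
  have hρs : ContDiff ℝ ∞ ρ := f.contDiff_normed
  have hρc : HasCompactSupport ρ := f.hasCompactSupport_normed
  have hui : Integrable (Ω.indicator u) := (integrable_indicator_iff hΩ.measurableSet).2 hu
  have hloc := hui.locallyIntegrable
  have hd := hρc.hasFDerivAt_convolution_left (lsmul ℝ ℝ) (hρs.of_le (by simp)) hloc x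
  -- The reflected, translated mollifier is supported in the closed ball around x that lies in Ω, so
  -- it may be inserted in the weak derivative identity.
  have hψ : IsTestFunction Ω fun y => ρ (x - y) := by
    have hcl : tsupport (fun y => ρ (x - y)) ⊆ Metric.closedBall x f.rOut := by
      apply closure_minimal _ Metric.isClosed_closedBall
      intro y hy
      have h1 : x - y ∈ tsupport ρ := subset_tsupport _ hy
      rw [hρ, f.tsupport_normed_eq, mem_closedBall_zero_iff] at h1
      rwa [mem_closedBall_iff_norm, norm_sub_rev]
    exact ⟨hρs.comp (by fun_prop), (isCompact_closedBall x f.rOut).of_isClosed_subset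
      (isClosed_tsupport _) hcl, hcl.trans hx⟩
  have hψd : ∀ y, fderiv ℝ (fun y => ρ (x - y)) y (unitVec i) = - fderiv ℝ ρ (x - y) (unitVec i) := by
    intro y
    have h1 : HasFDerivAt ρ (fderiv ℝ ρ (x - y)) (x - y) :=
      (hρs.differentiable (by simp) _).hasFDerivAt
    have h2 : HasFDerivAt (fun y : E3 => x - y) (-ContinuousLinearMap.id ℝ E3) y :=
      (hasFDerivAt_id y).const_sub x
    have h3 : fderiv ℝ (fun y => ρ (x - y)) y = _ := (h1.comp y h2).fderiv
    rw [h3]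
    simp
  rw [hd.fderiv, convolution_eq_swap, convolution_eq_swap]
  rw [ContinuousLinearMap.integral_apply]
  · have h1 := huv _ hψ
    simp only [hψd, neg_smul, integral_neg, neg_inj] at h1
    rw [← integral_indicator hΩ.measurableSet, ← integral_indicator hΩ.measurableSet] at h1
    refine Eq.trans (integral_congr_ae (Eventually.of_forall fun y => ?_))
      (h1.trans (integral_congr_ae (Eventually.of_forall fun y => ?_)))
    · by_cases hy : y ∈ Ω <;> simp [hy, precompL_apply]
    · by_cases hy : y ∈ Ω <;> simp [hy]
  · have := (hρc.fderiv (𝕜 := ℝ)).convolutionExists_left ((lsmul ℝ ℝ : ℝ →L[ℝ] F →L[ℝ] F).precompL E3)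
      (hρs.continuous_fderiv (by simp)) hloc x
    exact this.integrable_swap

end Mollify

/-! ### The chain rule for bounded Sobolev functions. -/

section ChainRule

variable {E : Type*} [NormedAddCommGroup E] [NormedSpace ℝ E] [FiniteDimensional ℝ E]
variable {F : Type*} [NormedAddCommGroup F] [NormedSpace ℝ F]

/-- Chain rule for bounded functions in `H¹`. -/
theorem IsSobolev.comp {Ω : Set E3} (hΩ : IsOpen Ω) (hΩb : Bornology.IsBounded Ω) {u : E3 → E}
    {g : Fin 3 → E3 → E} (hu : IsSobolev Ω u g) {M : ℝ} (hM : 0 ≤ M)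
    (huM : ∀ᵐ x ∂volume.restrict Ω, ‖u x‖ ≤ M) {G : E → F} (hG : ContDiff ℝ 1 G) :
    IsSobolev Ω (fun x => G (u x)) fun i x => fderiv ℝ G (u x) (g i x) := by
  have hfin : IsFiniteMeasure (volume.restrict Ω) :=
    ⟨by simpa using hΩb.measure_lt_top⟩
  have := FiniteDimensional.proper ℝ E
  have := FiniteDimensional.complete ℝ E
  have hGc := hG.continuous
  have hDc : Continuous (fderiv ℝ G) := hG.continuous_fderiv (by simp)
  obtain ⟨C₀, hC₀⟩ := (isCompact_closedBall (0 : E) M).exists_bound_of_continuousOn hGc.continuousOn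
  obtain ⟨C₁, hC₁⟩ := (isCompact_closedBall (0 : E) M).exists_bound_of_continuousOn hDc.continuousOn
  simp only [mem_closedBall_zero_iff] at hC₀ hC₁
  have hum := hu.memLp.aestronglyMeasurable
  have happ : AEStronglyMeasurable (fun x => fderiv ℝ G (u x)) (volume.restrict Ω) :=
    hDc.comp_aestronglyMeasurable hum
  refine ⟨MemLp.of_bound (hGc.comp_aestronglyMeasurable hum) C₀ ?_, fun i => ?_, fun i φ hφ => ?_⟩
  · filter_upwards [huM] with x hx using hC₀ _ hx
  · refine (hu.memLp_grad i).of_le_mul (c := C₁)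
      ((ContinuousLinearMap.id ℝ (E →L[ℝ] F)).aestronglyMeasurable_comp₂ happ
        (hu.memLp_grad i).aestronglyMeasurable) ?_
    filter_upwards [huM] with x hx
    exact (le_opNorm _ _).trans (by gcongr; exact hC₁ _ hx)
  -- mollification
  let f : ℕ → ContDiffBump (0 : E3) := fun n =>
    ⟨1 / (2 * (n + 1 : ℝ)), 1 / (n + 1 : ℝ), by positivity, by
      rw [div_lt_div_iff₀ (by positivity) (by positivity)]
      have : (0 : ℝ) ≤ n := n.cast_nonneg
      linarith⟩
  have hf : Tendsto (fun n => (f n).rOut) atTop (𝓝 0) := tendsto_one_div_add_atTop_nhds_zero_nat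
  -- A bounded ratio of the radii is what makes mollifications converge almost everywhere.
  have hK : ∀ n, (f n).rOut ≤ 2 * (f n).rIn := fun n => by
    simp only [f]
    apply le_of_eq
    field_simp
  have hρi : ∀ n, Integrable ((f n).normed volume) := fun n => (f n).integrable_normed
  have hui : Integrable u (volume.restrict Ω) := hu.memLp.integrable (by norm_num)
  have hgi : Integrable (g i) (volume.restrict Ω) := (hu.memLp_grad i).integrable (by norm_num)
  set v : E3 → E := Ω.indicator u with hv
  set w : E3 → E := Ω.indicator (g i) with hw
  have hvi : Integrable v := (integrable_indicator_iff hΩ.measurableSet).2 hui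
  have hwi : Integrable w := (integrable_indicator_iff hΩ.measurableSet).2 hgi
  have hvM : ∀ᵐ x, ‖v x‖ ≤ M := by
    filter_upwards [(ae_restrict_iff' hΩ.measurableSet).1 huM] with x hx
    by_cases hxΩ : x ∈ Ω
    · simpa [hv, hxΩ] using hx hxΩ
    · simpa [hv, hxΩ] using hM
  set un : ℕ → E3 → E := fun n => (f n).normed volume ⋆[lsmul ℝ ℝ, volume] v with hun
  set wn : ℕ → E3 → E := fun n => (f n).normed volume ⋆[lsmul ℝ ℝ, volume] w with hwn
  have huns : ∀ n, ContDiff ℝ 1 (un n) := fun n =>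
    (f n).hasCompactSupport_normed.contDiff_convolution_left _ (f n).contDiff_normed
      hvi.locallyIntegrable
  have hunl : ∀ᵐ x, Tendsto (fun n => un n x) atTop (𝓝 (v x)) :=
    ContDiffBump.ae_convolution_tendsto_right_of_locallyIntegrable hf (Eventually.of_forall hK)
      hvi.locallyIntegrable
  have hunM : ∀ n x, ‖un n x‖ ≤ M := by
    intro n x
    refine (norm_convolution_le_convolution_norm (f n).nonneg_normed v x).trans ?_
    rw [convolution_eq_swap]
    calc _ ≤ ∫ t, (f n).normed volume (x - t) * M := by
          refine integral_mono_of_nonneg (Eventually.of_forall fun t => ?_)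
            (((hρi n).comp_sub_left x).mul_const M) ?_
          · exact mul_nonneg ((f n).nonneg_normed _) (norm_nonneg _)
          · filter_upwards [hvM] with t ht
            exact mul_le_mul_of_nonneg_left ht ((f n).nonneg_normed _)
      _ = M := by
          rw [integral_mul_const, integral_sub_left_eq_self, (f n).integral_normed, one_mul]
  have hwni : ∀ n, Integrable (wn n) := fun n => (hρi n).integrable_convolution _ hwi
  have hφc := hφ.smooth.continuous
  have hφdc : Continuous fun x => fderiv ℝ φ x (unitVec i) :=
    (hφ.smooth.continuous_fderiv (by simp)).clm_apply continuous_const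
  have hφdcs : HasCompactSupport fun x => fderiv ℝ φ x (unitVec i) :=
    hφ.compact.fderiv_apply ℝ _
  obtain ⟨P, hP⟩ := hφ.compact.exists_bound_of_continuous hφc
  have hP0 : 0 ≤ P := (norm_nonneg _).trans (hP 0)
  have hGun : ∀ n, ContDiff ℝ 1 fun x => G (un n x) := fun n => hG.comp (huns n)
  -- limit of the left-hand side
  have hL : Tendsto (fun n => ∫ x, fderiv ℝ φ x (unitVec i) • G (un n x)) atTop
      (𝓝 (∫ x, fderiv ℝ φ x (unitVec i) • G (v x))) := by
    refine tendsto_integral_of_dominated_convergence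
      (fun x => ‖fderiv ℝ φ x (unitVec i)‖ * C₀)
      (fun n => (hφdc.smul (hGun n).continuous).aestronglyMeasurable)
      ((hφdc.integrable_of_hasCompactSupport hφdcs).norm.mul_const _) ?_ ?_
    · refine fun n => Eventually.of_forall fun x => ?_
      rw [norm_smul]
      gcongr
      exact hC₀ _ (hunM n x)
    · filter_upwards [hunl] with x hx
      exact ((hGc.tendsto _).comp hx).const_smul _
  -- The coefficients are bounded and converge almost everywhere, while the mollified gradients
  -- converge in L¹.
  have hR : Tendsto (fun n => ∫ x, (φ x • fderiv ℝ G (un n x)) (wn n x)) atTop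
      (𝓝 (∫ x, (φ x • fderiv ℝ G (v x)) (w x))) := by
    refine tendsto_integral_clm_apply (A := fun n x => φ x • fderiv ℝ G (un n x))
      (A₀ := fun x => φ x • fderiv ℝ G (v x)) (C := P * C₁)
      (fun n => (hφc.smul (hDc.comp (huns n).continuous)).aestronglyMeasurable)
      (fun n => Eventually.of_forall fun x => ?_) ?_ hwni hwi
      (tendsto_integral_norm_convolution_sub f hf hK hwi)
    · rw [norm_smul]
      gcongr
      · exact hP x
      · exact hC₁ _ (hunM n x)
    · filter_upwards [hunl] with x hx
      exact ((hDc.tendsto _).comp hx).const_smul _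
  -- the identity for mollified functions
  obtain ⟨δ, hδ, hδΩ⟩ := hφ.compact.isCompact.exists_cthickening_subset_open hΩ hφ.subset
  have hev : ∀ᶠ n in atTop, ∫ x, fderiv ℝ φ x (unitVec i) • G (un n x) =
      - ∫ x, (φ x • fderiv ℝ G (un n x)) (wn n x) := by
    filter_upwards [hf.eventually (ge_mem_nhds hδ)] with n hn
    have hi1 : Integrable fun x => fderiv ℝ φ x (unitVec i) • G (un n x) :=
      (hφdc.smul (hGun n).continuous).integrable_of_hasCompactSupport hφdcs.smul_right
    have hi2 : Integrable fun x => φ x • fderiv ℝ (fun x => G (un n x)) x (unitVec i) :=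
      (hφc.smul (((hGun n).continuous_fderiv (by simp)).clm_apply
        continuous_const)).integrable_of_hasCompactSupport hφ.compact.smul_right
    have hi3 : Integrable fun x => φ x • G (un n x) :=
      (hφc.smul (hGun n).continuous).integrable_of_hasCompactSupport hφ.compact.smul_right
    have hibp := integral_smul_fderiv_eq_neg_fderiv_smul_of_integrable hi1 hi2 hi3
      (fun x _ => hφ.smooth.differentiable (by simp) x)
      (fun x _ => (hGun n).differentiable (by simp) x)
    rw [eq_neg_iff_add_eq_zero, add_comm, ← eq_neg_iff_add_eq_zero, ← hibp]
    refine integral_congr_ae (Eventually.of_forall fun x => ?_)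
    by_cases hx : x ∈ tsupport φ
    · have hball : Metric.closedBall x (f n).rOut ⊆ Ω :=
        (Metric.closedBall_subset_closedBall hn).trans
          ((Metric.closedBall_subset_cthickening hx δ).trans hδΩ)
      have h1 : HasFDerivAt G (fderiv ℝ G (un n x)) (un n x) :=
        (hG.differentiable (by simp) _).hasFDerivAt
      have h2 : HasFDerivAt (un n) (fderiv ℝ (un n) x) x :=
        ((huns n).differentiable (by simp) _).hasFDerivAt
      have h3 : fderiv ℝ (fun x => G (un n x)) x = _ := (h1.comp x h2).fderiv
      have h4 : fderiv ℝ (un n) x (unitVec i) = wn n x :=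
        fderiv_convolution_eq hΩ hui (hu.weak i) (f n) hball
      simp only [h3, smul_apply, ContinuousLinearMap.comp_apply, h4]
    · simp [image_eq_zero_of_notMem_tsupport hx]
  have hfinal : ∫ x, fderiv ℝ φ x (unitVec i) • G (v x) =
      - ∫ x, (φ x • fderiv ℝ G (v x)) (w x) :=
    tendsto_nhds_unique (hL.congr' hev) hR.neg
  have hz : ∀ x, x ∉ Ω → φ x = 0 ∧ fderiv ℝ φ x (unitVec i) = 0 := by
    intro x hx
    have hx' : x ∉ tsupport φ := fun h => hx (hφ.subset h)
    refine ⟨image_eq_zero_of_notMem_tsupport hx', ?_⟩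
    have : x ∉ tsupport (fderiv ℝ φ) := fun h => hx' (tsupport_fderiv_subset ℝ h)
    simp [image_eq_zero_of_notMem_tsupport this]
  rw [← integral_indicator hΩ.measurableSet, ← integral_indicator hΩ.measurableSet]
  refine Eq.trans (integral_congr_ae (Eventually.of_forall fun x => ?_))
    (hfinal.trans (congrArg Neg.neg (integral_congr_ae (Eventually.of_forall fun x => ?_))))
  · by_cases hx : x ∈ Ω
    · simp [hx, hv]
    · simp [hx, (hz x hx).2]
  · by_cases hx : x ∈ Ω
    · simp [hx, hv, hw]
    · simp [hx, (hz x hx).1]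

end ChainRule

end LLG

namespace LLG

open Filter Topology
open scoped ENNReal

/-! ### Embedding of H²_N into W^{1,4} and L^∞. -/

section Space

variable {Ω : Set E3}

theorem H2N.isSobolev (v : H2N Ω) : IsSobolev Ω (H2N.fn v) fun i => H2N.partialDeriv v i :=
  ⟨Lp.memLp _, fun _ => Lp.memLp _, v.2.1⟩

theorem H2N.isSobolev_partialDeriv (v : H2N Ω) (i : Fin 3) :
    IsSobolev Ω (H2N.partialDeriv v i) fun j => (v.1 (Sum.inr (Sum.inr (i, j))) : L2 Ω) :=
  ⟨Lp.memLp _, fun _ => Lp.memLp _, v.2.2.1 i⟩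

theorem lintegral_enorm_sq_L2 (f : L2 Ω) : ∫⁻ x in Ω, ‖f x‖ₑ ^ 2 = ‖f‖ₑ ^ 2 := by
  rw [Lp.enorm_def, eLpNorm_eq_lintegral_rpow_enorm_toReal (by norm_num) (by norm_num),
    ← ENNReal.rpow_two, ← ENNReal.rpow_mul]
  norm_num

theorem H2N.lintegral_component_sq_le (v : H2N Ω) (k : JetIdx) :
    ∫⁻ x in Ω, ‖(v.1 k : L2 Ω) x‖ₑ ^ 2 ≤ ‖v‖ₑ ^ 2 := by
  rw [lintegral_enorm_sq_L2]
  gcongr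
  exact enorm_le_iff_norm_le.2 (PiLp.norm_apply_le v.1 k)

/-- The embedding `H² ⊂ W^{1,4} ∩ L^∞` on bounded sets. -/
theorem H2N.exists_uniform_bound (hΩ : IsBoundedC21Domain Ω) (K : ℝ) :
    ∃ M : ℝ, 0 ≤ M ∧ ∀ v : H2N Ω, ‖v‖ ≤ K → (∀ᵐ x ∂volume.restrict Ω, ‖H2N.fn v x‖ ≤ M) ∧
      ∀ i, ∫⁻ x in Ω, ‖H2N.partialDeriv v i x‖ₑ ^ 4 ≤ ENNReal.ofReal M := by
  have hemb := hΩ.embedsOn (F := E3)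
  obtain ⟨C, hC, h4⟩ := hemb.four 1 one_ne_zero
  obtain ⟨D, hD, htop⟩ := hemb.top
  set κ : ℝ≥0∞ := ENNReal.ofReal K
  -- `P` bounds ∫ |∂ᵢv|⁴, by the H¹ ⊂ L⁴ estimate for ∂ᵢv; `Q` below feeds this into W^{1,4} ⊂ L^∞
  -- and bounds |v|⁴.
  set P : ℝ≥0∞ := C * (κ ^ 2) ^ 2 + 1 * (3 * ∑ _j : Fin 3, κ ^ 2) ^ 2 with hPdef
  have hP : P ≠ ⊤ := by
    have : ∑ _j : Fin 3, κ ^ 2 ≠ ⊤ := by simp; finiteness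
    finiteness
  set Q : ℝ≥0∞ := D * ((κ ^ 2) ^ 2 + 27 * ∑ _j : Fin 3, P) with hQdef
  have hQ : Q ≠ ⊤ := by
    have : ∑ _j : Fin 3, P ≠ ⊤ := by simp; finiteness
    finiteness
  refine ⟨max 1 (max P.toReal Q.toReal), by positivity, fun v hv => ?_⟩
  have hvκ : ‖v‖ₑ ≤ κ := by
    rw [← ofReal_norm]; exact ENNReal.ofReal_le_ofReal hv
  have hcomp : ∀ k, ∫⁻ x in Ω, ‖(v.1 k : L2 Ω) x‖ₑ ^ 2 ≤ κ ^ 2 := fun k =>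
    (H2N.lintegral_component_sq_le v k).trans (by gcongr)
  have hgrad : ∀ i, ∫⁻ x in Ω, ‖H2N.partialDeriv v i x‖ₑ ^ 4 ≤ P := by
    intro i
    refine (h4 _ _ (H2N.isSobolev_partialDeriv v i)).trans ?_
    rw [hPdef]
    gcongr
    · exact hcomp _
    · refine (lintegral_gradSize_sq_le hΩ.isOpen (H2N.isSobolev_partialDeriv v i)).trans ?_
      gcongr
      exact hcomp _
  constructor
  · filter_upwards [htop _ _ (H2N.isSobolev v)] with x hx
    have h1 : ‖H2N.fn v x‖ₑ ^ 4 ≤ Q := by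
      refine hx.trans ?_
      rw [hQdef]
      gcongr
      · exact hcomp _
      · refine (lintegral_gradSize_pow_four_le hΩ.isOpen (H2N.isSobolev v)).trans ?_
        gcongr
        exact hgrad _
    have h2 : ‖H2N.fn v x‖ ^ 4 ≤ Q.toReal := by
      have := ENNReal.toReal_mono hQ h1
      rwa [ENNReal.toReal_pow, toReal_enorm] at this
    rcases le_total ‖H2N.fn v x‖ 1 with h | h
    · exact h.trans (le_max_left _ _)
    · exact (le_self_pow₀ h (by norm_num)).trans
        (h2.trans ((le_max_right _ _).trans (le_max_right _ _)))
  · intro i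
    refine (hgrad i).trans ?_
    refine (ENNReal.ofReal_toReal hP).symm.le.trans ?_
    exact ENNReal.ofReal_le_ofReal ((le_max_left _ _).trans (le_max_right _ _))

end Space

/-! ### Pointwise calculus of |y|² - 1. -/

section Functionals

/-- The deviation from the unit sphere. -/
noncomputable def sphereDefect (y : E3) : ℝ := ‖y‖ ^ 2 - 1

theorem contDiff_sphereDefect : ContDiff ℝ 1 sphereDefect :=
  (contDiff_norm_sq ℝ).sub contDiff_const

theorem fderiv_sphereDefect (y z : E3) : fderiv ℝ sphereDefect y z = 2 * inner ℝ y z := by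
  have h : HasFDerivAt sphereDefect (2 • (innerSL ℝ y)) y :=
    ((hasStrictFDerivAt_norm_sq y).hasFDerivAt).sub_const 1
  rw [h.fderiv]
  simp

theorem fderiv_sphereDefect_smul (y z : E3) :
    fderiv ℝ (fun y => sphereDefect y • y) y z =
      sphereDefect y • z + (2 * inner ℝ y z) • y := by
  have h1 : HasFDerivAt sphereDefect (fderiv ℝ sphereDefect y) y :=
    (contDiff_sphereDefect.differentiable (by simp) y).hasFDerivAt
  have h2 : fderiv ℝ (fun y => sphereDefect y • y) y = _ := (h1.smul (hasFDerivAt_id y)).fderiv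
  rw [h2]
  simp [fderiv_sphereDefect]

/-- With d = z - y the remainder is exactly 2 (|y|² - 1) |d|² + (|z|² - |y|²)², and ||z|² - |y|²| ≤
2M |d|. The quadratic bound integrates to the squared L² distance. -/
theorem abs_sphereDefect_sq_taylor_le {M : ℝ} {y z : E3} (hy : ‖y‖ ≤ M) (hz : ‖z‖ ≤ M) :
    |sphereDefect z ^ 2 - sphereDefect y ^ 2 - 4 * inner ℝ (sphereDefect y • y) (z - y)| ≤
      (6 * M ^ 2 + 2) * ‖z - y‖ ^ 2 := by
  have hM : 0 ≤ M := (norm_nonneg y).trans hy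
  set d := z - y with hd
  have hzd : z = y + d := by simp [hd]
  have hb : ‖z‖ ^ 2 = ‖y‖ ^ 2 + 2 * inner ℝ y d + ‖d‖ ^ 2 := by
    rw [hzd]; exact norm_add_sq_real y d
  have hba : |‖z‖ ^ 2 - ‖y‖ ^ 2| ≤ 2 * M * ‖d‖ := by
    have h1 : ‖z‖ ^ 2 - ‖y‖ ^ 2 = (‖z‖ - ‖y‖) * (‖z‖ + ‖y‖) := by ring
    rw [h1, abs_mul, abs_of_nonneg (by positivity : 0 ≤ ‖z‖ + ‖y‖)]
    calc |‖z‖ - ‖y‖| * (‖z‖ + ‖y‖) ≤ ‖d‖ * (M + M) := by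
          gcongr; exact abs_norm_sub_norm_le z y
      _ = _ := by ring
  have hsq : (‖z‖ ^ 2 - ‖y‖ ^ 2) ^ 2 ≤ 4 * M ^ 2 * ‖d‖ ^ 2 := by
    calc _ = |‖z‖ ^ 2 - ‖y‖ ^ 2| ^ 2 := (sq_abs _).symm
      _ ≤ (2 * M * ‖d‖) ^ 2 := by gcongr
      _ = _ := by ring
  have hy2 : ‖y‖ ^ 2 ≤ M ^ 2 := by gcongr
  have hexp : sphereDefect z ^ 2 - sphereDefect y ^ 2 -
      4 * inner ℝ (sphereDefect y • y) d =
      2 * (‖y‖ ^ 2 - 1) * ‖d‖ ^ 2 + (‖z‖ ^ 2 - ‖y‖ ^ 2) ^ 2 := by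
    rw [real_inner_smul_left]
    simp only [sphereDefect]
    rw [hb]
    ring
  rw [hexp, abs_le]
  have hd2 : 0 ≤ ‖d‖ ^ 2 := by positivity
  have hy0 : 0 ≤ ‖y‖ ^ 2 := by positivity
  have hM2 : 0 ≤ M ^ 2 := by positivity
  have hs0 : 0 ≤ (‖z‖ ^ 2 - ‖y‖ ^ 2) ^ 2 := by positivity
  have hp1 : ‖y‖ ^ 2 * ‖d‖ ^ 2 ≤ M ^ 2 * ‖d‖ ^ 2 := by gcongr
  have hp2 : 0 ≤ ‖y‖ ^ 2 * ‖d‖ ^ 2 := by positivity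
  constructor
  · have : 0 ≤ M ^ 2 * ‖d‖ ^ 2 := by positivity
    linarith
  · linarith

end Functionals

/-! ### Differentiability of the defect functional in time. -/

section Energy

variable {Ω : Set E3}

/-- The functional `∫_Ω (|q|² - 1)²` is differentiable along bounded differentiable curves. -/
theorem hasDerivWithinAt_integral_sphereDefect_sq (hΩb : Bornology.IsBounded Ω) {M : ℝ}
    {q : ℝ → L2 Ω} {q' : L2 Ω} {s : Set ℝ} {t : ℝ}
    (hq : HasDerivWithinAt q q' s t) (ht : t ∈ s)
    (hM : ∀ τ ∈ s, ∀ᵐ x ∂volume.restrict Ω, ‖q τ x‖ ≤ M) {G : L2 Ω}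
    (hG : ∀ᵐ x ∂volume.restrict Ω, G x = sphereDefect (q t x) • q t x) :
    HasDerivWithinAt (fun τ => ∫ x in Ω, sphereDefect (q τ x) ^ 2) (4 * inner ℝ G q') s t := by
  have hfin : IsFiniteMeasure (volume.restrict Ω) :=
    ⟨by simpa using hΩb.measure_lt_top⟩
  have hint : ∀ τ ∈ s, Integrable (fun x => sphereDefect (q τ x) ^ 2) (volume.restrict Ω) := by
    intro τ hτ
    have hc : Continuous fun y : E3 => sphereDefect y ^ 2 := contDiff_sphereDefect.continuous.pow 2
    obtain ⟨C, hC⟩ := (isCompact_closedBall (0 : E3) M).exists_bound_of_continuousOn hc.continuousOn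
    refine Integrable.of_bound (hc.comp_aestronglyMeasurable (Lp.aestronglyMeasurable _)) C ?_
    filter_upwards [hM τ hτ] with x hx
    exact hC _ (by simpa using hx)
  have hrem : ∀ τ ∈ s, ‖(∫ x in Ω, sphereDefect (q τ x) ^ 2) -
      (∫ x in Ω, sphereDefect (q t x) ^ 2) - 4 * inner ℝ G (q τ - q t)‖ ≤
      (6 * M ^ 2 + 2) * ‖q τ - q t‖ ^ 2 := by
    intro τ hτ
    have hi := L2.integrable_inner (𝕜 := ℝ) G (q τ - q t)
    have hsq : ‖q τ - q t‖ ^ 2 = ∫ x in Ω, ‖(q τ - q t) x‖ ^ 2 := by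
      rw [← real_inner_self_eq_norm_sq, L2.inner_def]
      simp only [real_inner_self_eq_norm_sq]
    have hsqi : Integrable (fun x => ‖(q τ - q t) x‖ ^ 2) (volume.restrict Ω) := by
      simpa only [real_inner_self_eq_norm_sq] using
        L2.integrable_inner (𝕜 := ℝ) (q τ - q t) (q τ - q t)
    have hdi : Integrable (fun x => sphereDefect (q τ x) ^ 2 - sphereDefect (q t x) ^ 2)
        (volume.restrict Ω) := (hint τ hτ).sub (hint t ht)
    rw [L2.inner_def, ← integral_const_mul, ← integral_sub (hint τ hτ) (hint t ht),
      ← integral_sub hdi (hi.const_mul 4), hsq, ← integral_const_mul]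
    refine norm_integral_le_of_norm_le (hsqi.const_mul _) ?_
    filter_upwards [hM τ hτ, hM t ht, hG, Lp.coeFn_sub (q τ) (q t)] with x h1 h2 h3 h4
    rw [h3, h4]
    exact abs_sphereDefect_sq_taylor_le h2 h1
  have hlin : HasDerivWithinAt (fun τ => 4 * inner ℝ G (q τ - q t)) (4 * inner ℝ G q') s t := by
    have h1 := ((innerSL ℝ G).hasFDerivAt (x := q t)).comp_hasDerivWithinAt t hq
    have h2 := (h1.sub_const (inner ℝ G (q t))).const_mul 4
    refine h2.congr (fun τ _ => ?_) ?_
    · simp [inner_sub_right]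
    · simp
  have hR : HasDerivWithinAt (fun τ => (∫ x in Ω, sphereDefect (q τ x) ^ 2) -
      (∫ x in Ω, sphereDefect (q t x) ^ 2) - 4 * inner ℝ G (q τ - q t)) 0 s t := by
    rw [hasDerivWithinAt_iff_isLittleO]
    simp only [sub_self, inner_zero_right, mul_zero, sub_zero, smul_zero]
    have hO : (fun τ => q τ - q t) =O[𝓝[s] t] fun τ => τ - t := hq.hasFDerivWithinAt.isBigO_sub
    have ho : (fun τ => q τ - q t) =o[𝓝[s] t] fun _ => (1 : ℝ) := by
      rw [Asymptotics.isLittleO_one_iff]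
      have := hq.continuousWithinAt.tendsto.sub_const (q t)
      simpa using this
    have hprod : (fun τ => ‖q τ - q t‖ * ‖q τ - q t‖) =o[𝓝[s] t] fun τ => (1 : ℝ) * (τ - t) :=
      ho.norm_left.mul_isBigO hO.norm_left
    simp only [one_mul] at hprod
    -- The remainder is O(‖q τ - q t‖²); one factor tends to zero, the other is O(τ - t).
    refine Asymptotics.IsBigO.trans_isLittleO
      (Asymptotics.IsBigO.of_bound (6 * M ^ 2 + 2) ?_) hprod
    filter_upwards [self_mem_nhdsWithin] with τ hτ
    refine (hrem τ hτ).trans_eq ?_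
    rw [norm_mul, norm_norm, sq ‖q τ - q t‖]
  have hsum := (hR.add hlin).add_const (∫ x in Ω, sphereDefect (q t x) ^ 2)
  rw [zero_add] at hsum
  refine hsum.congr (fun τ _ => ?_) ?_
  · simp
  · simp

end Energy

end LLG

namespace LLG

open Filter Topology
open scoped ENNReal

theorem inner_self_cross (a b : E3) : inner ℝ a (cross a b) = 0 := by
  simp [cross, PiLp.inner_apply, Fin.sum_univ_three, cross_apply]
  ring

theorem lintegral_mul_sq_le {X : Type*} [MeasurableSpace X] (μ : Measure X) {f g : X → ℝ≥0∞}
    (hf : AEMeasurable f μ) (hg : AEMeasurable g μ) :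
    (∫⁻ x, f x * g x ∂μ) ^ 2 ≤ (∫⁻ x, f x ^ 2 ∂μ) * ∫⁻ x, g x ^ 2 ∂μ := by
  have h := ENNReal.lintegral_mul_le_Lp_mul_Lq μ (p := 2) (q := 2)
    (Real.HolderConjugate.two_two) hf hg
  simp only [Pi.mul_apply, ENNReal.rpow_two] at h
  calc _ ≤ ((∫⁻ x, f x ^ 2 ∂μ) ^ (1 / 2 : ℝ) * (∫⁻ x, g x ^ 2 ∂μ) ^ (1 / 2 : ℝ)) ^ 2 := by
        gcongr
    _ = _ := by
        rw [mul_pow, ← ENNReal.rpow_two, ← ENNReal.rpow_two, ← ENNReal.rpow_mul,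
          ← ENNReal.rpow_mul]
        norm_num

theorem ofReal_integral_sq {X : Type*} [MeasurableSpace X] {μ : Measure X} {f : X → ℝ}
    (hf : MemLp f 2 μ) : ENNReal.ofReal (∫ x, f x ^ 2 ∂μ) = ∫⁻ x, ‖f x‖ₑ ^ 2 ∂μ := by
  rw [ofReal_integral_eq_lintegral_ofReal hf.integrable_sq
    (Eventually.of_forall fun x => sq_nonneg _)]
  refine lintegral_congr fun x => ?_
  rw [← ofReal_norm, ← ENNReal.ofReal_pow (norm_nonneg _), Real.norm_eq_abs, sq_abs]

/-! ### Energy estimate: absorption and testing of the equation. -/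

section Energy

variable {Ω : Set E3}

/-- The a priori estimate absorbing `∫ w² |∇v|²`, `w = |v|² - 1`, into `∫ |∇w|²` and `∫ w²`. -/
theorem H2N.exists_absorption (hΩ : IsBoundedC21Domain Ω) (K : ℝ) :
    ∃ Λ : ℝ, ∀ v : H2N Ω, ‖v‖ ≤ K →
      Integrable (fun x => sphereDefect (fn v x) ^ 2 * ∑ i, ‖partialDeriv v i x‖ ^ 2)
        (volume.restrict Ω) ∧
      (∀ i, Integrable (fun x => inner ℝ (fn v x) (partialDeriv v i x) ^ 2)
        (volume.restrict Ω)) ∧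
      (∫ x in Ω, sphereDefect (fn v x) ^ 2 * ∑ i, ‖partialDeriv v i x‖ ^ 2) -
        2 * ∑ i, ∫ x in Ω, inner ℝ (fn v x) (partialDeriv v i x) ^ 2 ≤
        Λ * ∫ x in Ω, sphereDefect (fn v x) ^ 2 := by
  obtain ⟨M, hM, hbound⟩ := exists_uniform_bound hΩ K
  -- This ε turns (3 · 4H)² times the bound 9 (M + 1) for the gradient factor into exactly H².
  -- Taking M + 1 keeps the denominator positive when M = 0.
  obtain ⟨C, hC, h4⟩ := (hΩ.embedsOn (F := ℝ)).four (ENNReal.ofReal (1 / (9 * 9 * (M + 1) * 16)))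
    (by rw [Ne, ENNReal.ofReal_eq_zero, not_le]; positivity)
  set Cr := C.toReal
  have hCr : 0 ≤ Cr := ENNReal.toReal_nonneg
  refine ⟨Real.sqrt (Cr * (9 * (M + 1))), fun v hv => ?_⟩
  obtain ⟨hvM, hgM⟩ := hbound v hv
  set q := fn v
  set g := fun i => partialDeriv v i
  have hw : IsSobolev Ω (fun x => sphereDefect (q x))
      fun i x => fderiv ℝ sphereDefect (q x) (g i x) :=
    (H2N.isSobolev v).comp hΩ.isOpen hΩ.isBounded hM hvM contDiff_sphereDefect
  have hd : ∀ i x, fderiv ℝ sphereDefect (q x) (g i x) = 2 * inner ℝ (q x) (g i x) :=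
    fun i x => fderiv_sphereDefect _ _
  have hwi : Integrable (fun x => sphereDefect (q x) ^ 2) (volume.restrict Ω) :=
    hw.memLp.integrable_sq
  have hhi : ∀ i, Integrable (fun x => (inner ℝ (q x) (g i x)) ^ 2) (volume.restrict Ω) := by
    intro i
    have h1 := (hw.memLp_grad i).integrable_sq.const_mul (1 / 4)
    refine h1.congr (Eventually.of_forall fun x => ?_)
    simp only [hd]
    ring
  have hgm : ∀ i, AEStronglyMeasurable (g i) (volume.restrict Ω) := fun i =>
    Lp.aestronglyMeasurable _
  set N : ℝ := ∫ x in Ω, sphereDefect (q x) ^ 2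
  set H : ℝ := ∑ i, ∫ x in Ω, inner ℝ (q x) (g i x) ^ 2
  have hN0 : 0 ≤ N := integral_nonneg fun x => sq_nonneg _
  have hH0 : 0 ≤ H := Finset.sum_nonneg fun i _ => integral_nonneg fun x => sq_nonneg _
  have hN : ∫⁻ x in Ω, ‖sphereDefect (q x)‖ₑ ^ 2 = ENNReal.ofReal N :=
    (ofReal_integral_sq hw.memLp).symm
  have hH : ∑ i, ∫⁻ x in Ω, ‖fderiv ℝ sphereDefect (q x) (g i x)‖ₑ ^ 2 =
      ENNReal.ofReal (4 * H) := by
    rw [Finset.mul_sum, ENNReal.ofReal_sum_of_nonneg fun i _ =>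
      mul_nonneg (by norm_num) (integral_nonneg fun x => sq_nonneg _)]
    refine Finset.sum_congr rfl fun i _ => ?_
    rw [← ofReal_integral_sq (hw.memLp_grad i), ← integral_const_mul]
    simp only [hd]
    congr 2
    ext x
    ring
  have hw4 : ∫⁻ x in Ω, ‖sphereDefect (q x)‖ₑ ^ 4 ≤ ENNReal.ofReal
      (Cr * N ^ 2 + 1 / (9 * 9 * (M + 1) * 16) * (3 * (4 * H)) ^ 2) := by
    refine (h4 _ _ hw).trans ?_
    rw [ENNReal.ofReal_add (by positivity) (by positivity), ENNReal.ofReal_mul hCr,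
      ENNReal.ofReal_mul (by positivity), ENNReal.ofReal_toReal hC, hN,
      ENNReal.ofReal_pow hN0, ENNReal.ofReal_pow (by positivity),
      ENNReal.ofReal_mul (by norm_num : (0 : ℝ) ≤ 3), ← hH]
    gcongr
    refine (lintegral_gradSize_sq_le hΩ.isOpen hw).trans_eq ?_
    simp
  have hg4 : ∫⁻ x in Ω, (∑ i, ‖g i x‖ₑ ^ 2) ^ 2 ≤ ENNReal.ofReal (9 * (M + 1)) := by
    calc _ ≤ ∫⁻ x in Ω, 3 * ∑ i, ‖g i x‖ₑ ^ 4 := by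
          refine lintegral_mono fun x => (sum_three_sq_le _).trans_eq ?_
          simp only [← pow_mul]
      _ = 3 * ∑ i, ∫⁻ x in Ω, ‖g i x‖ₑ ^ 4 := by
          rw [lintegral_const_mul' _ _ (by norm_num),
            lintegral_finsetSum' _ fun i _ => (hgm i).enorm.pow_const 4]
      _ ≤ 3 * ∑ _i : Fin 3, ENNReal.ofReal M := by
          gcongr with i
          exact hgM i
      _ = ENNReal.ofReal (9 * M) := by
          rw [Finset.sum_const, ENNReal.ofReal_mul (by norm_num)]
          simp [← mul_assoc]
          norm_num
      _ ≤ _ := ENNReal.ofReal_le_ofReal (by linarith)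
  set A := ∫⁻ x in Ω, ‖sphereDefect (q x)‖ₑ ^ 2 * ∑ i, ‖g i x‖ₑ ^ 2
  -- Cauchy-Schwarz gives A² ≤ 9 (M + 1) Cr N² + H², below the square of the sum; the allowance 2H
  -- is the good gradient term.
  have hA2 : A ^ 2 ≤ ENNReal.ofReal ((Real.sqrt (Cr * (9 * (M + 1))) * N + 2 * H) ^ 2) := by
    have h1 := lintegral_mul_sq_le (volume.restrict Ω)
      (hw.memLp.aestronglyMeasurable.enorm.pow_const 2)
      (Finset.aemeasurable_fun_sum _ fun i _ => (hgm i).enorm.pow_const 2 :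
        AEMeasurable (fun x => ∑ i, ‖g i x‖ₑ ^ 2) (volume.restrict Ω))
    simp only [← pow_mul] at h1
    refine h1.trans ((mul_le_mul' hw4 hg4).trans ?_)
    rw [← ENNReal.ofReal_mul (by positivity)]
    apply ENNReal.ofReal_le_ofReal
    have h2 : (Cr * N ^ 2 + 1 / (9 * 9 * (M + 1) * 16) * (3 * (4 * H)) ^ 2) * (9 * (M + 1)) =
        Cr * (9 * (M + 1)) * N ^ 2 + H ^ 2 := by
      field_simp
      ring
    have h3 : Real.sqrt (Cr * (9 * (M + 1))) ^ 2 = Cr * (9 * (M + 1)) :=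
      Real.sq_sqrt (by positivity)
    have h4 : 0 ≤ Real.sqrt (Cr * (9 * (M + 1))) * N * H := by positivity
    have h5 : (Real.sqrt (Cr * (9 * (M + 1))) * N + 2 * H) ^ 2 =
        Real.sqrt (Cr * (9 * (M + 1))) ^ 2 * N ^ 2 +
          4 * (Real.sqrt (Cr * (9 * (M + 1))) * N * H) + 4 * H ^ 2 := by ring
    rw [h2, h5, h3]
    linarith [sq_nonneg H]
  have hA : A ≤ ENNReal.ofReal (Real.sqrt (Cr * (9 * (M + 1))) * N + 2 * H) := by
    rw [ENNReal.ofReal_pow (by positivity)] at hA2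
    exact (ENNReal.pow_le_pow_left_iff two_ne_zero).1 hA2
  have hAeq : ∫⁻ x in Ω, ENNReal.ofReal (sphereDefect (q x) ^ 2 * ∑ i, ‖g i x‖ ^ 2) = A := by
    refine lintegral_congr fun x => ?_
    rw [ENNReal.ofReal_mul (sq_nonneg _), ENNReal.ofReal_sum_of_nonneg fun i _ => sq_nonneg _]
    congr 1
    · rw [← ofReal_norm, ← ENNReal.ofReal_pow (norm_nonneg _), Real.norm_eq_abs, sq_abs]
    · exact Finset.sum_congr rfl fun i _ => by
        rw [ENNReal.ofReal_pow (norm_nonneg _), ofReal_norm]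
  have hmeas : AEStronglyMeasurable (fun x => sphereDefect (q x) ^ 2 * ∑ i, ‖g i x‖ ^ 2)
      (volume.restrict Ω) :=
    hwi.aestronglyMeasurable.mul
      (Finset.aestronglyMeasurable_fun_sum _ fun i _ => (hgm i).norm.pow 2)
  have hnn : ∀ x, 0 ≤ sphereDefect (q x) ^ 2 * ∑ i, ‖g i x‖ ^ 2 := fun x => by positivity
  have hAi : Integrable (fun x => sphereDefect (q x) ^ 2 * ∑ i, ‖g i x‖ ^ 2)
      (volume.restrict Ω) := by
    refine ⟨hmeas, ?_⟩
    rw [hasFiniteIntegral_iff_ofReal (Eventually.of_forall hnn), hAeq]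
    exact hA.trans_lt ENNReal.ofReal_lt_top
  refine ⟨hAi, hhi, ?_⟩
  have hle : ∫ x in Ω, sphereDefect (q x) ^ 2 * ∑ i, ‖g i x‖ ^ 2 ≤
      Real.sqrt (Cr * (9 * (M + 1))) * N + 2 * H := by
    rw [← ENNReal.ofReal_le_ofReal_iff (by positivity),
      ofReal_integral_eq_lintegral_ofReal hAi (Eventually.of_forall hnn), hAeq]
    exact hA
  linarith

/-- Testing the projected equation with `(|v|² - 1) v`, using the Neumann condition. -/
theorem H2N.inner_sphereDefect_smul (hΩ : IsBoundedC21Domain Ω) {M : ℝ} (hM : 0 ≤ M)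
    (v : H2N Ω) (hvM : ∀ᵐ x ∂volume.restrict Ω, ‖fn v x‖ ≤ M)
    (hi : Integrable (fun x => sphereDefect (fn v x) ^ 2 * ∑ i, ‖partialDeriv v i x‖ ^ 2)
        (volume.restrict Ω))
    (hhi : ∀ i, Integrable (fun x => inner ℝ (fn v x) (partialDeriv v i x) ^ 2)
        (volume.restrict Ω)) {G q' : L2 Ω}
    (hG : ∀ᵐ x ∂volume.restrict Ω, G x = sphereDefect (fn v x) • fn v x)
    (hq' : ∀ᵐ x ∂volume.restrict Ω, inner ℝ (fn v x) (q' x) =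
      inner ℝ (fn v x) (laplacian v x) + (∑ i, ‖partialDeriv v i x‖ ^ 2) * ‖fn v x‖ ^ 2) :
    inner ℝ G q' =
      (∫ x in Ω, sphereDefect (fn v x) ^ 2 * ∑ i, ‖partialDeriv v i x‖ ^ 2) -
        2 * ∑ i, ∫ x in Ω, inner ℝ (fn v x) (partialDeriv v i x) ^ 2 := by
  have hS : IsSobolev Ω (fun x => sphereDefect (fn v x) • fn v x)
      fun i x => fderiv ℝ (fun y => sphereDefect y • y) (fn v x) (partialDeriv v i x) :=
    (H2N.isSobolev v).comp hΩ.isOpen hΩ.isBounded hM hvM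
      (contDiff_sphereDefect.smul contDiff_id)
  set Ψ : Fin 3 → L2 Ω := fun i => (hS.memLp_grad i).toLp _
  have hΨ : ∀ i, ∀ᵐ x ∂volume.restrict Ω, Ψ i x = sphereDefect (fn v x) • partialDeriv v i x +
      (2 * inner ℝ (fn v x) (partialDeriv v i x)) • fn v x := by
    intro i
    filter_upwards [(hS.memLp_grad i).coeFn_toLp] with x hx
    rw [hx, fderiv_sphereDefect_smul]
  have hweak : ∀ i, HasWeakPartial Ω i G (Ψ i) := by
    intro i φ hφ
    have h := hS.weak i φ hφ
    refine Eq.trans (integral_congr_ae ?_) (h.trans (congrArg Neg.neg (integral_congr_ae ?_)))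
    · filter_upwards [hG] with x hx
      rw [hx]
    · filter_upwards [(hS.memLp_grad i).coeFn_toLp] with x hx
      rw [hx]
  -- The weak Neumann condition admits every H¹ test function, so (|v|² - 1) v need not vanish on
  -- the boundary.
  have hN := v.2.2.2 G Ψ hweak
  have hN' : ∑ i, inner ℝ (partialDeriv v i) (Ψ i) = - inner ℝ (laplacian v) G := hN
  have hdiff : inner ℝ G (q' - laplacian v) = inner ℝ G q' + ∑ i, inner ℝ (partialDeriv v i) (Ψ i) := by
    rw [hN', inner_sub_right, real_inner_comm G (laplacian v), sub_eq_add_neg]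
  have hkey : inner ℝ G q' = inner ℝ G (q' - laplacian v) -
      ∑ i, inner ℝ (partialDeriv v i) (Ψ i) := by
    rw [hdiff]; ring
  have hi1 : ∀ i, Integrable (fun x => inner ℝ (partialDeriv v i x) (Ψ i x)) (volume.restrict Ω) :=
    fun i => L2.integrable_inner (𝕜 := ℝ) _ _
  have hi2 : Integrable (fun x => inner ℝ (G x) ((q' - laplacian v) x)) (volume.restrict Ω) :=
    L2.integrable_inner (𝕜 := ℝ) _ _
  rw [hkey]
  simp only [L2.inner_def]
  rw [← integral_finsetSum _ fun i _ => hi1 i, ← integral_finsetSum _ fun i _ => hhi i,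
    ← integral_const_mul, ← integral_sub hi2 (integrable_finsetSum _ fun i _ => hi1 i),
    ← integral_sub hi ((integrable_finsetSum _ fun i _ => hhi i).const_mul 2)]
  refine integral_congr_ae ?_
  filter_upwards [hG, hq', ae_all_iff.2 hΨ, Lp.coeFn_sub q' (laplacian v)] with x h1 h2 h3 h4
  simp only [h1, h3, h4, Pi.sub_apply, real_inner_smul_left, inner_sub_right, inner_add_right,
    real_inner_smul_right, real_inner_self_eq_norm_sq, h2]
  have hc : ∀ i, inner ℝ (partialDeriv v i x) (fn v x) = inner ℝ (fn v x) (partialDeriv v i x) :=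
    fun i => real_inner_comm _ _
  -- The cancellation: the reaction term w |v|² |∇v|² minus the diffusion term w |∇v|² is w² |∇v|².
  simp only [hc, Fin.sum_univ_three, sphereDefect]
  ring

end Energy

end LLG

/-! ### Conclusion by Grönwall's inequality. -/

open LLG in
theorem mainTheorem8 (Ω : Set LLG.E3) (hΩ : LLG.IsBoundedC21Domain Ω)
    (α η T β : ℝ) (hη : 0 < η) (hT : 0 < T) (hβ : 0 < β) (hβ' : β < 1)
    (h : ℝ → LLG.L2 Ω) (hh : ∃ C : ℝ, ∀ s t : ℝ, ‖h s - h t‖ ≤ C * |s - t| ^ β)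
    (lam : ℝ) (u : LLG.H2N Ω) (hu : ∀ᵐ x ∂(volume.restrict Ω), ‖LLG.H2N.fn u x‖ = 1)
    (m : ℝ → LLG.H2N Ω) (hm : LLG.IsSolution Ω α η T β h lam u m) :
    ∀ t ∈ Icc 0 T, ∀ᵐ x ∂(volume.restrict Ω), ‖LLG.H2N.fn (m t) x‖ = 1 := by
  -- Continuity into H²_N on the compact interval makes all constants uniform in t.
  obtain ⟨K, hK⟩ := (isCompact_Icc (a := (0 : ℝ)) (b := T)).exists_bound_of_continuousOn
    hm.memX.continuousOn
  obtain ⟨M, hM, hbound⟩ := H2N.exists_uniform_bound hΩ K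
  obtain ⟨Λ, hΛ⟩ := H2N.exists_absorption hΩ K
  have hvM : ∀ t ∈ Icc 0 T, ∀ᵐ x ∂volume.restrict Ω, ‖H2N.fn (m t) x‖ ≤ M := fun t ht =>
    (hbound _ (hK t ht)).1
  set N : ℝ → ℝ := fun t => ∫ x in Ω, sphereDefect (H2N.fn (m t) x) ^ 2 with hNdef
  have hSob : ∀ t ∈ Icc 0 T, IsSobolev Ω (fun x => sphereDefect (H2N.fn (m t) x)) _ := fun t ht =>
    (H2N.isSobolev (m t)).comp hΩ.isOpen hΩ.isBounded hM (hvM t ht) contDiff_sphereDefect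
  have hderiv : ∀ t ∈ Icc 0 T, ∃ d, HasDerivWithinAt N d (Icc 0 T) t ∧ d ≤ 4 * Λ * N t := by
    intro t ht
    obtain ⟨hi, hhi, hle⟩ := hΛ (m t) (hK t ht)
    have hmem := ((H2N.isSobolev (m t)).comp hΩ.isOpen hΩ.isBounded hM (hvM t ht)
      (contDiff_sphereDefect.smul contDiff_id)).memLp
    have hG := hmem.coeFn_toLp
    have hq := ((hm.memX.contDiffOn.differentiableOn (by simp)) t ht).hasDerivWithinAt
    refine ⟨_, hasDerivWithinAt_integral_sphereDefect_sq hΩ.isBounded hq ht hvM hG, ?_⟩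
    obtain ⟨Hm, -, heq⟩ := hm.equation t ht
    rw [H2N.inner_sphereDefect_smul hΩ hM (m t) (hvM t ht) hi hhi hG ?_]
    · linarith
    -- Only the component of m_t along m is needed, and all vector products with m drop out.
    · filter_upwards [heq] with x hx
      rw [hx]
      simp only [inner_sub_right, inner_add_right, real_inner_smul_right, inner_self_cross,
        real_inner_self_eq_norm_sq]
      ring
  choose! d hd hdle using hderiv
  have hN0 : N 0 ≤ 0 := by
    apply le_of_eq
    simp only [hNdef]
    rw [hm.initial]
    refine integral_eq_zero_of_ae ?_
    filter_upwards [hu] with x hx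
    simp [sphereDefect, hx]
  -- With zero initial value and zero inhomogeneity the Grönwall bound vanishes identically,
  -- whatever the sign of Λ.
  have hgron := le_gronwallBound_of_liminf_deriv_right_le (f := N) (f' := d) (δ := 0)
    (K := 4 * Λ) (ε := 0) (a := 0) (b := T) (fun t ht => (hd t ht).continuousWithinAt)
    (fun t ht r hr => ((hd t (Ico_subset_Icc_self ht)).mono_of_mem_nhdsWithin
      (Icc_mem_nhdsGE_of_mem ht)).liminf_right_slope_le hr) hN0
    (fun t ht => by simpa using hdle t (Ico_subset_Icc_self ht))
  intro t ht
  have hNt : N t ≤ 0 := by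
    have := hgron t ht
    rwa [gronwallBound_ε0, zero_mul] at this
  have hNz : N t = 0 := le_antisymm hNt (integral_nonneg fun x => sq_nonneg _)
  have hz := (integral_eq_zero_iff_of_nonneg (fun x => sq_nonneg _)
    (hSob t ht).memLp.integrable_sq).1 hNz
  filter_upwards [hz] with x hx
  have h1 : sphereDefect (H2N.fn (m t) x) = 0 := by simpa using hx
  have h2 : ‖H2N.fn (m t) x‖ ^ 2 = 1 := sub_eq_zero.1 h1
  exact (pow_eq_one_iff_of_nonneg (norm_nonneg _) two_ne_zero).1 h2
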